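/- Let $A\in\mathbb R^{n\times n}$, $B\in\mathbb R^{n\times l}$, $E\in\mathbb R^{n\times m}$, $z,s\in\mathbb R^n$, $v\in\mathbb R^l$, $c\in\mathbb R$, let $(A,B)$ be stabilizable, and let $Q_1,Q_2\in\mathbb R^{n\times n}$, $R_1,R_2\in\mathbb R^{l\times l}$ be symmetric with $Q_1,Q_2,R_2\ge 0$ and $R_1>0$. Let $W(0),W(1),\dots$ be i.i.d. square-integrable $\mathbb R^m$-valued random variables on a probability space $(\Omega,\mathcal F,\mathbb P)$ with mean $\mu_W$. Put $f(x,u,w)=Ax+Bu+Ew+z$ and, for square-integrable $X$ and $U$, $$\ell(X,U)=\mathbb E\big[X^TQ_1X+U^TR_1U+s^TX+v^TU+c\big]+\mathrm{Tr}(Q_2\,\mathrm{Cov}(X))+\mathrm{Tr}(R_2\,\mathrm{Cov}(U)).$$ For a square-integrable initial value $X_0$ and a control process $U(\cdot)$ let $X_U(0)=X_0$, $X_U(k+1)=f(X_U(k),U(k),W(k))$ and $J_N(X_0,U)=\sum_{k=0}^{N-1}\ell(X_U(k),U(k))$. Control processes on the horizon $\{0,\dots,N-1\}$ are those with $U(k)$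 square-integrable and $W(k)$ independent of $X_U(k)$ and of $U(k)$ for all $k<N$. Assume that the equation $(I-A)x-Bu=E\mu_W+z$ of deterministic steady states has a solution and that $(A,Q_1^{1/2})$ is detectable. Then there exist: * a positive semidefinite solution $P$ of the Riccati equation $P=A^TPA+Q_1+Q_2-A^TPB[R_1+R_2+B^TPB]^{-1}B^TPA$; put $K=-[R_1+R_2+B^TPB]^{-1}B^TPA$; * a steady state $(x_e,u_e)$ that minimizes $x^TQ_1x+u^TR_1u+s^Tx+v^Tu+c$ among all solutions of the steady-state equation; * a probability measure $\varrho$ on $\mathbb R^n$ with finite second moment; * a continuous, strictly increasing, unbounded function $\alpha:[0,\infty)\to[0,\infty)$ with $\alpha(0)=0$; such that the following hold for the processes $(X^s_\star,U^s_\star)$ with $$X^s_\star(0)\sim\varrho,\quad U^s_\star(k)=K(X^s_\star(k)-x_e)+u_e,\quad X^s_\star(k+1)=f(X^s_\star(k),U^s_\star(k),W(k)),\quad W(k)\text{ independent of }X^s_\star(k)\quad(k\ge 0).$$ 1. Such processes exist on $\Omega$ whenever $\Omega$ carries a random variable uniformly distributed on $[0,1]$ and independent of the sequence $(W(k))_{k\ge0}$.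 2. Every such pair is stationary: the laws of $X^s_\star(k)$ and of $U^s_\star(k)$ have finite second moments and do not depend on $k$. The problem is strictly dissipative in $L^2$ at it with comparison function $\alpha$: there is a storage function $\lambda:\mathbb N_0\times L^2(\Omega;\mathbb R^n)\to\mathbb R$, bounded from below, with $$\ell(X,U)-\ell(X^s_\star(k),U^s_\star(k))+\lambda(k,X)-\lambda(k+1,f(X,U,W(k)))\ \ge\ \alpha\big(\mathbb E\|X-X^s_\star(k)\|^2\big)$$ for all $k$ and all square-integrable $X,U$ that are each independent of $W(k)$. 3. (Pathwise turnpike in probability.) For every such pair and every square-integrable $X_0$ there is a constant $C\in\mathbb R$ such that for all $N\in\mathbb N_0$, all $\delta>0$, all control processes $U(\cdot)$ with $J_N(X_0,U)\le\delta+\sum_{k=0}^{N-1}\ell(X^s_\star(k),U^s_\star(k))$ and all $\varepsilon,\eta>0$, $$\#\big\{k\in\{0,\dots,N-1\}\ \big|\ \mathbb P(\|X_U(k)-X^s_\star(k)\|\ge\varepsilon)\le\eta\big\}\ \ge\ N-\frac{\delta+C}{\alpha(\varepsilon^2\eta)}.$$ -/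

import Mathlib

open MeasureTheory ProbabilityTheory Matrix

noncomputable section

namespace StochLQ

/-- Data of a generalized stochastic linear-quadratic optimal control problem with state dimension
`n`, control dimension `l` and noise dimension `m`. -/
structure LQProblem (n l m : ℕ) where
  A : Matrix (Fin n) (Fin n) ℝ
  B : Matrix (Fin n) (Fin l) ℝ
  E : Matrix (Fin n) (Fin m) ℝ
  z : EuclideanSpace ℝ (Fin n)
  Q₁ : Matrix (Fin n) (Fin n) ℝ
  Q₂ : Matrix (Fin n) (Fin n) ℝ
  R₁ : Matrix (Fin l) (Fin l) ℝ
  R₂ : Matrix (Fin l) (Fin l) ℝ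
  s : EuclideanSpace ℝ (Fin n)
  v : EuclideanSpace ℝ (Fin l)
  c : ℝ

/-! ### Linear systems -/

/-- All complex eigenvalues lie in the open unit disc. -/
def IsSchurStable {n : ℕ} (M : Matrix (Fin n) (Fin n) ℝ) : Prop :=
  ∀ r ∈ spectrum ℂ (M.map (algebraMap ℝ ℂ)), ‖r‖ < 1

/-- `(A, B)` is stabilizable. -/
def IsStabilizable {n l : ℕ} (A : Matrix (Fin n) (Fin n) ℝ) (B : Matrix (Fin n) (Fin l) ℝ) : Prop :=
  ∃ F : Matrix (Fin l) (Fin n) ℝ, IsSchurStable (A + B * F)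

/-- `(A, C)` is detectable. -/
def IsDetectable {n q : ℕ} (A : Matrix (Fin n) (Fin n) ℝ) (C : Matrix (Fin q) (Fin n) ℝ) : Prop :=
  ∃ L : Matrix (Fin n) (Fin q) ℝ, IsSchurStable (A + L * C)

open scoped MatrixOrder in
/-- The positive semidefinite square root of a positive semidefinite matrix. -/
def psdSqrt {n : ℕ} (Q : Matrix (Fin n) (Fin n) ℝ) : Matrix (Fin n) (Fin n) ℝ :=
  CFC.sqrt Q

/-- Comparison functions of class `𝒦_∞` (only the values on `[0, ∞)` matter). -/
structure IsKInfty (α : ℝ → ℝ) : Prop where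
  continuousOn : ContinuousOn α (Set.Ici 0)
  strictMonoOn : StrictMonoOn α (Set.Ici 0)
  map_zero : α 0 = 0
  unbounded : ∀ M : ℝ, ∃ r : ℝ, 0 ≤ r ∧ M < α r

/-! ### Covariance matrices -/

/-- The covariance matrix of a random vector. -/
def covMatrix {Ω : Type*} [MeasurableSpace Ω] {d : ℕ} (μ : Measure Ω)
    (X : Ω → EuclideanSpace ℝ (Fin d)) : Matrix (Fin d) (Fin d) ℝ :=
  Matrix.of fun i j => covariance (fun ω => X ω i) (fun ω => X ω j) μ

namespace LQProblem

variable {n l m : ℕ} (p : LQProblem n l m)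

/-- The dynamics `f(x, u, w) = A x + B u + E w + z`. -/
def f (x : EuclideanSpace ℝ (Fin n)) (u : EuclideanSpace ℝ (Fin l))
    (w : EuclideanSpace ℝ (Fin m)) : EuclideanSpace ℝ (Fin n) :=
  toEuclideanLin p.A x + toEuclideanLin p.B u + toEuclideanLin p.E w + p.z

/-- The deterministic stage cost `xᵀ Q₁ x + uᵀ R₁ u + sᵀ x + vᵀ u + c`. -/
def detStageCost (x : EuclideanSpace ℝ (Fin n)) (u : EuclideanSpace ℝ (Fin l)) : ℝ :=
  inner ℝ x (toEuclideanLin p.Q₁ x) + inner ℝ u (toEuclideanLin p.R₁ u)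
    + inner ℝ p.s x + inner ℝ p.v u + p.c

/-- `(x, u)` is a steady state of the deterministic system with the noise replaced by its mean
`w`. -/
def IsSteadyState (w : EuclideanSpace ℝ (Fin m)) (x : EuclideanSpace ℝ (Fin n))
    (u : EuclideanSpace ℝ (Fin l)) : Prop :=
  x = p.f x u w

/-- `(x, u)` is a steady state of minimal deterministic stage cost. -/
def IsOptimalSteadyState (w : EuclideanSpace ℝ (Fin m)) (x : EuclideanSpace ℝ (Fin n))
    (u : EuclideanSpace ℝ (Fin l)) : Prop :=
  p.IsSteadyState w x u ∧
    ∀ x' u', p.IsSteadyState w x' u' → p.detStageCost x u ≤ p.detStageCost x' u'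

/-- `P` is a positive semidefinite solution of the discrete-time algebraic Riccati equation for the
weights `Q₁ + Q₂` and `R₁ + R₂`. -/
def IsRiccatiSolution (P : Matrix (Fin n) (Fin n) ℝ) : Prop :=
  P.PosSemidef ∧
    P = p.Aᵀ * P * p.A + (p.Q₁ + p.Q₂)
      - p.Aᵀ * P * p.B * ((p.R₁ + p.R₂) + p.Bᵀ * P * p.B)⁻¹ * p.Bᵀ * P * p.A

/-- The feedback gain `K = -[(R₁ + R₂) + Bᵀ P B]⁻¹ Bᵀ P A`. -/
def gain (P : Matrix (Fin n) (Fin n) ℝ) : Matrix (Fin l) (Fin n) ℝ :=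
  -(((p.R₁ + p.R₂) + p.Bᵀ * P * p.B)⁻¹ * p.Bᵀ * P * p.A)

variable {Ω : Type*} [MeasurableSpace Ω] (μ : Measure Ω) (W : ℕ → Ω → EuclideanSpace ℝ (Fin m))

/-- The stochastic stage cost. -/
def stageCost (X : Ω → EuclideanSpace ℝ (Fin n)) (U : Ω → EuclideanSpace ℝ (Fin l)) : ℝ :=
  (∫ ω, p.detStageCost (X ω) (U ω) ∂μ)
    + ((p.Q₂ * covMatrix μ X).trace + (p.R₂ * covMatrix μ U).trace)

/-- The state process `X_U(·, X₀)`. -/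
def traj (X₀ : Ω → EuclideanSpace ℝ (Fin n)) (U : ℕ → Ω → EuclideanSpace ℝ (Fin l)) :
    ℕ → Ω → EuclideanSpace ℝ (Fin n)
  | 0 => X₀
  | k + 1 => fun ω => p.f (traj X₀ U k ω) (U k ω) (W k ω)

/-- The cost `J_N(X₀, U) = ∑_{k < N} ℓ(X(k), U(k))`. -/
def cost (N : ℕ) (X₀ : Ω → EuclideanSpace ℝ (Fin n))
    (U : ℕ → Ω → EuclideanSpace ℝ (Fin l)) : ℝ :=
  ∑ k ∈ Finset.range N, p.stageCost μ (p.traj W X₀ U k) (U k)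

/-- Admissible control processes on the horizon `{0, …, N - 1}`: the controls are
square-integrable and `W k` is independent of the state and of the control at time `k`. If `X₀` is
independent of the noise sequence, this contains all square-integrable controls that are adapted
to the filtration `σ(X(0), …, X(k))` generated by the state process. -/
structure IsAdmissible (N : ℕ) (X₀ : Ω → EuclideanSpace ℝ (Fin n))
    (U : ℕ → Ω → EuclideanSpace ℝ (Fin l)) : Prop where
  memLp : ∀ k < N, MemLp (U k) 2 μ
  indep_state : ∀ k < N, IndepFun (p.traj W X₀ U k) (W k) μ
  indep_control : ∀ k < N, IndepFun (U k) (W k) μ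

/-- `ϱ` is a probability measure with finite second moment. -/
def _root_.StochLQ.IsP2 {d : ℕ} (ϱ : Measure (EuclideanSpace ℝ (Fin d))) : Prop :=
  IsProbabilityMeasure ϱ ∧ ∫⁻ x, ‖x‖ₑ ^ 2 ∂ϱ < ⊤

/-- Stationary pairs of state and control processes for the noise sequence `W`. As for every state
and control process of the system, `W k` is independent of the state and control at time `k`. -/
def IsStationaryPair (Xs : ℕ → Ω → EuclideanSpace ℝ (Fin n))
    (Us : ℕ → Ω → EuclideanSpace ℝ (Fin l)) : Prop :=
  ∃ (ϱX : Measure (EuclideanSpace ℝ (Fin n))) (ϱU : Measure (EuclideanSpace ℝ (Fin l))),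
    IsP2 ϱX ∧ IsP2 ϱU ∧
    ∀ k, HasLaw (Xs k) ϱX μ ∧ HasLaw (Us k) ϱU μ ∧
      IndepFun (Xs k) (W k) μ ∧ IndepFun (Us k) (W k) μ ∧
      Xs (k + 1) =ᵐ[μ] fun ω => p.f (Xs k ω) (Us k ω) (W k ω)

/-- The problem is strictly dissipative in `L²` at `(Xs, Us)` with the comparison function `α`: there
is a time-varying storage function `stor` on `L²` (a function of random vectors that respects
almost sure equality), uniformly bounded from below, satisfying the dissipation inequality for all
square-integrable `X`, `U` that are independent of `W k`. -/
def IsStrictlyDissipativeWith (Xs : ℕ → Ω → EuclideanSpace ℝ (Fin n))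
    (Us : ℕ → Ω → EuclideanSpace ℝ (Fin l)) (α : ℝ → ℝ) : Prop :=
  IsKInfty α ∧
  ∃ stor : ℕ → (Ω → EuclideanSpace ℝ (Fin n)) → ℝ,
    (∀ k X Y, X =ᵐ[μ] Y → stor k X = stor k Y) ∧
    (∃ M : ℝ, ∀ k X, MemLp X 2 μ → M ≤ stor k X) ∧
    ∀ (k : ℕ) (X : Ω → EuclideanSpace ℝ (Fin n)) (U : Ω → EuclideanSpace ℝ (Fin l)),
      MemLp X 2 μ → MemLp U 2 μ → IndepFun X (W k) μ → IndepFun U (W k) μ →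
      α (∫ ω, ‖X ω - Xs k ω‖ ^ 2 ∂μ) ≤
        p.stageCost μ X U - p.stageCost μ (Xs k) (Us k)
          + stor k X - stor (k + 1) (fun ω => p.f (X ω) (U ω) (W k ω))

/-- `(Xs, Us)` is a solution of the system under the affine feedback
`U = K (X - xe) + ue`, started with the law `ϱ`, and `W k` is independent of the state at
time `k`. -/
structure IsFeedbackSolution (K : Matrix (Fin l) (Fin n) ℝ) (xe : EuclideanSpace ℝ (Fin n))
    (ue : EuclideanSpace ℝ (Fin l)) (ϱ : Measure (EuclideanSpace ℝ (Fin n)))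
    (Xs : ℕ → Ω → EuclideanSpace ℝ (Fin n)) (Us : ℕ → Ω → EuclideanSpace ℝ (Fin l)) : Prop where
  law_zero : HasLaw (Xs 0) ϱ μ
  indep : ∀ k, IndepFun (Xs k) (W k) μ
  feedback : ∀ k, Us k =ᵐ[μ] fun ω => toEuclideanLin K (Xs k ω - xe) + ue
  step : ∀ k, Xs (k + 1) =ᵐ[μ] fun ω => p.f (Xs k ω) (Us k ω) (W k ω)

open Classical in
/-- The number `𝒮_{ε,η}` of times `k < N` with `ℙ(‖X k - Xs k‖ ≥ ε) ≤ η`. -/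
def _root_.StochLQ.turnpikeCount {d : ℕ} (X Xs : ℕ → Ω → EuclideanSpace ℝ (Fin d)) (N : ℕ)
    (ε η : ℝ) : ℕ :=
  ((Finset.range N).filter fun k => μ.real {ω | ε ≤ ‖X k ω - Xs k ω‖} ≤ η).card

end LQProblem

end StochLQ

end

namespace StochLQ

/-! ### Quadratic forms of matrices on Euclidean space -/

section MatrixForms

variable {n l m : ℕ}

/-! Put `D = X - Xs`, `V = U - Us`, `Y = Xs - xe`. The increment of the stage cost from `(Xs, Us)`
to `(X, U)` has a part linear in `(D, V)` and a quadratic one. The storage function `E[νᵀD - 2 DᵀPY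
+ DᵀSD]` absorbs the linear part with its first two terms and makes the quadratic part strict with
the third.

Linear part: the covariance terms are convex, hence bounded below by their linearisation
(`le_trace_mul_covMatrix_sub`). Split `Xs = xe + Y` and `Us = ue + KY`. The terms at `(xe, ue)` form
the derivative of the deterministic cost and are cancelled by the Lagrange multiplier `ν` of the
optimal steady state (`exists_optimalSteadyState`). The terms in `Y` carry the weights `Q₁ + Q₂`,
`R₁ + R₂` and are cancelled by `-2 DᵀPY` through the polarised Riccati equation
(`IsRiccatiSolution.inner_eq`). Additive noise drops out of the successor of `D` and enters that of
`Y` as a centred term, which contributes nothing in expectation (`storage_step`).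

Quadratic part: detectability supplies a positive definite `S` with `DᵀQ₁D + VᵀR₁V + DᵀSD - (AD +
BV)ᵀS(AD + BV) ≥ c‖D‖²` (`IsDetectable.exists_storage`), so dissipativity holds with `α r = c * r`.
Positive definiteness of `S` also bounds the storage from below (`neg_le_storage`).

The same `S` makes the cost definite along directions of steady states, which yields the optimal
one, and makes `P + S` a Lyapunov function of the closed loop `M = A + BK`. Hence `∑ M^j E (W j -
w)` converges, and the translate of its law by `xe` is the stationary law. The matrix `P` is the
limit of value iteration. The turnpike estimate follows by telescoping the dissipation inequality
and applying Markov's inequality. -/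

lemma toEuclideanLin_mul_apply (M : Matrix (Fin n) (Fin m) ℝ) (N : Matrix (Fin m) (Fin l) ℝ)
    (x : EuclideanSpace ℝ (Fin l)) :
    toEuclideanLin (M * N) x = toEuclideanLin M (toEuclideanLin N x) := by
  simp [Matrix.toLpLin_apply, Matrix.mulVec_mulVec]

lemma toEuclideanLin_one_apply (x : EuclideanSpace ℝ (Fin n)) :
    toEuclideanLin (1 : Matrix (Fin n) (Fin n) ℝ) x = x := by
  simp

lemma inner_toEuclideanLin_transpose (M : Matrix (Fin n) (Fin m) ℝ)
    (x : EuclideanSpace ℝ (Fin m)) (y : EuclideanSpace ℝ (Fin n)) :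
    inner ℝ x (toEuclideanLin Mᵀ y) = inner ℝ (toEuclideanLin M x) y := by
  have h : Mᵀ = Mᴴ := by simp
  rw [h, Matrix.toEuclideanLin_conjTranspose_eq_adjoint, LinearMap.adjoint_inner_right]

lemma inner_toEuclideanLin_comm {M : Matrix (Fin n) (Fin n) ℝ} (hM : M.IsHermitian)
    (x y : EuclideanSpace ℝ (Fin n)) :
    inner ℝ x (toEuclideanLin M y) = inner ℝ y (toEuclideanLin M x) := by
  have h : Mᵀ = M := by rw [← conjTranspose_eq_transpose_of_trivial, hM.eq]
  conv_lhs => rw [← h, inner_toEuclideanLin_transpose, real_inner_comm]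

lemma inner_toEuclideanLin_nonneg {M : Matrix (Fin n) (Fin n) ℝ} (hM : M.PosSemidef)
    (x : EuclideanSpace ℝ (Fin n)) : 0 ≤ inner ℝ x (toEuclideanLin M x) := by
  have h := (Matrix.isPositive_toEuclideanLin_iff.2 hM).2 x
  rw [real_inner_comm]
  exact h

lemma posSemidef_of_inner_nonneg {M : Matrix (Fin n) (Fin n) ℝ} (hM : M.IsHermitian)
    (h : ∀ x : EuclideanSpace ℝ (Fin n), 0 ≤ inner ℝ x (toEuclideanLin M x)) : M.PosSemidef := by
  rw [← Matrix.isPositive_toEuclideanLin_iff]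
  refine ⟨fun x y => ?_, fun x => ?_⟩
  · rw [real_inner_comm, inner_toEuclideanLin_comm hM]
  · rw [real_inner_comm]
    exact h x

lemma inner_toEuclideanLin_eq_dotProduct (M : Matrix (Fin n) (Fin m) ℝ)
    (x : EuclideanSpace ℝ (Fin n)) (y : EuclideanSpace ℝ (Fin m)) :
    inner ℝ x (toEuclideanLin M y) = x.ofLp ⬝ᵥ (M *ᵥ y.ofLp) := by
  simp [EuclideanSpace.inner_eq_star_dotProduct, dotProduct_comm]

lemma exists_norm_toEuclideanLin_le (M : Matrix (Fin n) (Fin m) ℝ) :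
    ∃ C : ℝ, 0 < C ∧ ∀ x, ‖toEuclideanLin M x‖ ≤ C * ‖x‖ := by
  obtain ⟨C, hC, h⟩ := (LinearMap.toContinuousLinearMap (toEuclideanLin M)).isBoundedLinearMap.bound
  exact ⟨C, hC, h⟩

lemma exists_inner_toEuclideanLin_le (M : Matrix (Fin n) (Fin n) ℝ) :
    ∃ C : ℝ, 0 < C ∧ ∀ x, inner ℝ x (toEuclideanLin M x) ≤ C * ‖x‖ ^ 2 := by
  obtain ⟨C, hC, h⟩ := exists_norm_toEuclideanLin_le M
  refine ⟨C, hC, fun x => ?_⟩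
  calc inner ℝ x (toEuclideanLin M x) ≤ ‖x‖ * ‖toEuclideanLin M x‖ := real_inner_le_norm _ _
    _ ≤ ‖x‖ * (C * ‖x‖) := by gcongr; exact h x
    _ = C * ‖x‖ ^ 2 := by ring

lemma inner_toEuclideanLin_pos {M : Matrix (Fin n) (Fin n) ℝ} (hM : M.PosDef)
    {x : EuclideanSpace ℝ (Fin n)} (hx : x ≠ 0) : 0 < inner ℝ x (toEuclideanLin M x) := by
  rw [inner_toEuclideanLin_eq_dotProduct]
  simpa using hM.dotProduct_mulVec_pos (x := x.ofLp) (by simpa using hx)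

lemma posDef_of_inner_pos {M : Matrix (Fin n) (Fin n) ℝ} (hM : M.IsHermitian)
    (h : ∀ x : EuclideanSpace ℝ (Fin n), x ≠ 0 → 0 < inner ℝ x (toEuclideanLin M x)) :
    M.PosDef := by
  refine Matrix.PosDef.of_dotProduct_mulVec_pos hM fun {x} hx => ?_
  have := h (WithLp.toLp 2 x) (by simpa using hx)
  rw [inner_toEuclideanLin_eq_dotProduct] at this
  simpa using this

/-- The form attains a positive minimum on the compact unit sphere, and homogeneity extends the
bound. In dimension zero the sphere is empty. -/
lemma exists_le_inner_toEuclideanLin {M : Matrix (Fin n) (Fin n) ℝ} (hM : M.PosDef) :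
    ∃ c : ℝ, 0 < c ∧ ∀ x, c * ‖x‖ ^ 2 ≤ inner ℝ x (toEuclideanLin M x) := by
  set T := LinearMap.toContinuousLinearMap (toEuclideanLin M) with hT
  have hcont : Continuous fun x => inner ℝ x (toEuclideanLin M x) :=
    continuous_id.inner T.continuous
  rcases (Metric.sphere (0 : EuclideanSpace ℝ (Fin n)) 1).eq_empty_or_nonempty with he | hne
  · refine ⟨1, one_pos, fun x => ?_⟩
    have hx : x = 0 := by
      by_contra hx
      have : (‖x‖⁻¹ • x) ∈ Metric.sphere (0 : EuclideanSpace ℝ (Fin n)) 1 := by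
        simp [norm_smul, hx]
      simp [he] at this
    simp [hx]
  · obtain ⟨y, hy, hmin⟩ := (isCompact_sphere (0 : EuclideanSpace ℝ (Fin n)) 1).exists_isMinOn hne
      hcont.continuousOn
    have hy0 : y ≠ 0 := by
      rintro rfl
      simp at hy
    refine ⟨_, inner_toEuclideanLin_pos hM hy0, fun x => ?_⟩
    rcases eq_or_ne x 0 with rfl | hx
    · simp
    have hx' : ‖x‖ ≠ 0 := by simpa using hx
    have h := hmin (show (‖x‖⁻¹ • x) ∈ Metric.sphere (0 : EuclideanSpace ℝ (Fin n)) 1 by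
      simp [norm_smul, hx])
    simp only [Set.mem_ofPred_eq, map_smul, inner_smul_left, inner_smul_right] at h
    simp only [conj_trivial] at h
    calc _ ≤ (‖x‖⁻¹ * (‖x‖⁻¹ * inner ℝ x (toEuclideanLin M x))) * ‖x‖ ^ 2 := by gcongr
      _ = _ := by field_simp

/-- Young's inequality for the seminorm of `S`: expand the nonnegative form at `ε • a - b` and
divide by `ε`. -/
lemma inner_add_toEuclideanLin_add_le {S : Matrix (Fin n) (Fin n) ℝ} (hS : S.PosSemidef)
    {ε : ℝ} (hε : 0 < ε) (a b : EuclideanSpace ℝ (Fin n)) :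
    inner ℝ (a + b) (toEuclideanLin S (a + b)) ≤
      (1 + ε) * inner ℝ a (toEuclideanLin S a) + (1 + ε⁻¹) * inner ℝ b (toEuclideanLin S b) := by
  have h := inner_toEuclideanLin_nonneg hS (ε • a - b)
  have hc := inner_toEuclideanLin_comm hS.1 b a
  simp only [map_add, map_sub, map_smul, inner_add_left, inner_add_right, inner_sub_left,
    inner_sub_right, inner_smul_left, inner_smul_right, conj_trivial] at h ⊢
  have h' := mul_nonneg (inv_nonneg.2 hε.le) h
  have e : ε⁻¹ * (ε * (ε * inner ℝ a (toEuclideanLin S a) - inner ℝ a (toEuclideanLin S b)) -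
      (ε * inner ℝ b (toEuclideanLin S a) - inner ℝ b (toEuclideanLin S b))) =
      ε * inner ℝ a (toEuclideanLin S a) - inner ℝ a (toEuclideanLin S b)
        - inner ℝ b (toEuclideanLin S a) + ε⁻¹ * inner ℝ b (toEuclideanLin S b) := by
    field_simp
    ring
  linarith

end MatrixForms

/-! ### Lyapunov functions -/

section Lyapunov

variable {n l m : ℕ}

/-- Gelfand's formula gives `‖N ^ k‖ ≤ r ^ k` eventually, with some `r < 1`, for the complexified
matrix. -/
lemma IsSchurStable.tendsto_pow {M : Matrix (Fin n) (Fin n) ℝ} (hM : IsSchurStable M) :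
    Filter.Tendsto (fun k => M ^ k) Filter.atTop (nhds 0) := by
  rcases subsingleton_or_nontrivial (Matrix (Fin n) (Fin n) ℂ) with hs | hnt
  · have : ∀ k, M ^ k = 0 := fun k => by
      have h := congrArg (fun N : Matrix (Fin n) (Fin n) ℂ => N)
        (hs.elim ((M ^ k).map (algebraMap ℝ ℂ)) 0)
      ext i j
      simpa using congrFun (congrFun h i) j
    simp [this]
  let : NormedRing (Matrix (Fin n) (Fin n) ℂ) := Matrix.linftyOpNormedRing
  let : NormedAlgebra ℂ (Matrix (Fin n) (Fin n) ℂ) := Matrix.linftyOpNormedAlgebra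
  set N : Matrix (Fin n) (Fin n) ℂ := M.map (algebraMap ℝ ℂ) with hN
  have hrad : spectralRadius ℂ N < (1 : NNReal) :=
    spectrum.spectralRadius_lt_of_forall_lt N fun z hz => by
      exact_mod_cast hM z hz
  obtain ⟨r, hr1, hr2⟩ := ENNReal.lt_iff_exists_nnreal_btwn.1 hrad
  have hr2' : (r : ℝ) < 1 := by exact_mod_cast hr2
  have hev :=
    (spectrum.pow_nnnorm_pow_one_div_tendsto_nhds_spectralRadius N).eventually_lt_const hr1
  have hle : ∀ᶠ k : ℕ in Filter.atTop, ‖N ^ k‖ ≤ (r : ℝ) ^ k := by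
    filter_upwards [hev, Filter.eventually_gt_atTop 0] with k hk hk0
    have hk0' : (k : ℝ) ≠ 0 := by positivity
    have h2 : ((‖N ^ k‖₊ : ENNReal) ^ (1 / k : ℝ)) ^ (k : ℝ) ≤ (r : ENNReal) ^ (k : ℝ) :=
      ENNReal.rpow_le_rpow hk.le (by positivity)
    rw [← ENNReal.rpow_mul, one_div_mul_cancel hk0', ENNReal.rpow_one, ENNReal.rpow_natCast] at h2
    exact_mod_cast h2
  have hN0 : Filter.Tendsto (fun k => N ^ k) Filter.atTop (nhds 0) :=
    squeeze_zero_norm' hle (tendsto_pow_atTop_nhds_zero_of_lt_one r.2 hr2')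
  refine tendsto_pi_nhds.2 fun i => tendsto_pi_nhds.2 fun j => ?_
  have h : Filter.Tendsto (fun k => ((N ^ k) i j).re) Filter.atTop
      (nhds ((0 : Matrix (Fin n) (Fin n) ℂ) i j).re) := ((Complex.continuous_re.tendsto _).comp
    (((continuous_apply j).tendsto _).comp (((continuous_apply i).tendsto _).comp hN0)))
  have e : ∀ k, (N ^ k) i j = ((M ^ k) i j : ℂ) := fun k => by
    have : N ^ k = (M ^ k).map (algebraMap ℝ ℂ) := by
      rw [hN, ← RingHom.mapMatrix_apply, ← RingHom.mapMatrix_apply, map_pow]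
    rw [this]
    rfl
  simpa [e] using h

/-- A Schur stable matrix has a strict quadratic Lyapunov function. -/
lemma IsSchurStable.exists_lyapunov {M : Matrix (Fin n) (Fin n) ℝ} (hM : IsSchurStable M) :
    ∃ S : Matrix (Fin n) (Fin n) ℝ, S.PosDef ∧ ∃ c : ℝ, 0 < c ∧ ∀ x,
      inner ℝ (toEuclideanLin M x) (toEuclideanLin S (toEuclideanLin M x)) ≤
        inner ℝ x (toEuclideanLin S x) - c * ‖x‖ ^ 2 := by
  have h0 : Filter.Tendsto (fun k => LinearMap.toContinuousLinearMap (toEuclideanLin (M ^ k)))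
      Filter.atTop (nhds 0) := by
    have hc : Continuous fun N : Matrix (Fin n) (Fin n) ℝ =>
        LinearMap.toContinuousLinearMap (toEuclideanLin N) :=
      (LinearMap.toContinuousLinearMap.toLinearMap ∘ₗ
        (toEuclideanLin (𝕜 := ℝ) (m := Fin n)
          (n := Fin n)).toLinearMap).continuous_of_finiteDimensional
    simpa [Function.comp_def] using (hc.tendsto 0).comp hM.tendsto_pow
  -- Once `‖M ^ k‖ < 1/2`, the finite sum of `(M ^ j)ᵀ * M ^ j` over `j < k` suffices: along `M` its
  -- form telescopes to a change of `‖M ^ k x‖² - ‖x‖² ≤ -(3/4) ‖x‖²`. The condition `k > 0` keeps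
  -- the summand `j = 0`, which makes it positive definite.
  obtain ⟨k, hk⟩ := ((tendsto_zero_iff_norm_tendsto_zero.1 h0).eventually_lt_const
    (show (0 : ℝ) < 1 / 2 by norm_num)).and (Filter.eventually_gt_atTop 0) |>.exists
  have hform : ∀ x, inner ℝ x (toEuclideanLin (∑ j ∈ Finset.range k, (M ^ j)ᵀ * M ^ j) x) =
      ∑ j ∈ Finset.range k, ‖toEuclideanLin (M ^ j) x‖ ^ 2 := fun x => by
    rw [map_sum, LinearMap.sum_apply, inner_sum]
    refine Finset.sum_congr rfl fun j _ => ?_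
    rw [toEuclideanLin_mul_apply, inner_toEuclideanLin_transpose, real_inner_self_eq_norm_sq]
  refine ⟨∑ j ∈ Finset.range k, (M ^ j)ᵀ * M ^ j, ?_, 3 / 4, by norm_num, fun x => ?_⟩
  · refine posDef_of_inner_pos ?_ fun x hx => ?_
    · rw [IsHermitian, conjTranspose_sum]
      simp [transpose_mul, -transpose_pow]
    · rw [hform]
      refine lt_of_lt_of_le ?_ (Finset.single_le_sum (f := fun j => ‖toEuclideanLin (M ^ j) x‖ ^ 2)
        (fun j _ => by positivity) (Finset.mem_range.2 hk.2))
      simp only [pow_zero, toEuclideanLin_one_apply]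
      positivity
  · rw [hform, hform]
    have e : ∀ j, toEuclideanLin (M ^ j) (toEuclideanLin M x) = toEuclideanLin (M ^ (j + 1)) x :=
      fun j => by rw [pow_succ, toEuclideanLin_mul_apply]
    simp only [e]
    have h1 := Finset.sum_range_succ (fun j => ‖toEuclideanLin (M ^ j) x‖ ^ 2) k
    rw [Finset.sum_range_succ'] at h1
    simp only [pow_zero, toEuclideanLin_one_apply] at h1
    have h2 : ‖toEuclideanLin (M ^ k) x‖ ≤ 1 / 2 * ‖x‖ :=
      (LinearMap.toContinuousLinearMap (toEuclideanLin (M ^ k))).le_of_opNorm_le hk.1.le x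
    have h3 : ‖toEuclideanLin (M ^ k) x‖ ^ 2 ≤ (1 / 2 * ‖x‖) ^ 2 := by gcongr
    nlinarith

lemma psdSqrt_isHermitian {Q : Matrix (Fin n) (Fin n) ℝ} : (psdSqrt Q).IsHermitian := by
  open scoped MatrixOrder in
  have h : (0 : Matrix (Fin n) (Fin n) ℝ) ≤ CFC.sqrt Q := CFC.sqrt_nonneg Q
  exact (Matrix.nonneg_iff_posSemidef.1 h).1

open scoped MatrixOrder in
lemma psdSqrt_mul_self {Q : Matrix (Fin n) (Fin n) ℝ} (hQ : Q.PosSemidef) :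
    psdSqrt Q * psdSqrt Q = Q :=
  CFC.sqrt_mul_sqrt_self Q (Matrix.nonneg_iff_posSemidef.2 hQ)

lemma norm_toEuclideanLin_psdSqrt_sq {Q : Matrix (Fin n) (Fin n) ℝ} (hQ : Q.PosSemidef)
    (x : EuclideanSpace ℝ (Fin n)) :
    ‖toEuclideanLin (psdSqrt Q) x‖ ^ 2 = inner ℝ x (toEuclideanLin Q x) := by
  have h : (psdSqrt Q)ᵀ = psdSqrt Q := by
    rw [← conjTranspose_eq_transpose_of_trivial, psdSqrt_isHermitian.eq]
  conv_rhs => rw [← psdSqrt_mul_self hQ, toEuclideanLin_mul_apply]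
  nth_rewrite 2 [← h]
  rw [inner_toEuclideanLin_transpose, real_inner_self_eq_norm_sq]

/-- Detectability yields a quadratic storage function that makes the stage cost strictly
dissipative in the state. -/
lemma IsDetectable.exists_storage {A : Matrix (Fin n) (Fin n) ℝ} {B : Matrix (Fin n) (Fin l) ℝ}
    {Q : Matrix (Fin n) (Fin n) ℝ} {R : Matrix (Fin l) (Fin l) ℝ}
    (hdet : IsDetectable A (psdSqrt Q)) (hQ : Q.PosSemidef) (hR : R.PosDef) :
    ∃ S : Matrix (Fin n) (Fin n) ℝ, S.PosDef ∧ ∃ c : ℝ, 0 < c ∧ ∀ x u,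
      c * ‖x‖ ^ 2 ≤ inner ℝ x (toEuclideanLin Q x) + inner ℝ u (toEuclideanLin R u)
        + inner ℝ x (toEuclideanLin S x)
        - inner ℝ (toEuclideanLin A x + toEuclideanLin B u)
          (toEuclideanLin S (toEuclideanLin A x + toEuclideanLin B u)) := by
  obtain ⟨G, hG⟩ := hdet
  obtain ⟨S, hS, c, hc, hlyap⟩ := hG.exists_lyapunov
  obtain ⟨s, hs, hSle⟩ := exists_inner_toEuclideanLin_le S
  obtain ⟨g, hg, hGle⟩ := exists_norm_toEuclideanLin_le G
  obtain ⟨b, hb, hBle⟩ := exists_norm_toEuclideanLin_le B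
  obtain ⟨r, hr, hRle⟩ := exists_le_inner_toEuclideanLin hR
  -- Since `ε * s = c / 2`, Young's inequality loses at most half of the Lyapunov decrease.
  set ε := c / (2 * s) with hε
  have hε0 : 0 < ε := by positivity
  -- The factor by which the perturbation `d` is bounded in terms of the stage cost; dividing `S` by
  -- `κ` at the end normalises it to one.
  set κ := (1 + ε⁻¹) * s * (2 * g ^ 2 + 2 * b ^ 2 / r) with hκ
  have hκ0 : 0 < κ := by positivity
  have key : ∀ x u, inner ℝ (toEuclideanLin A x + toEuclideanLin B u)
        (toEuclideanLin S (toEuclideanLin A x + toEuclideanLin B u)) ≤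
      inner ℝ x (toEuclideanLin S x) - c / 2 * ‖x‖ ^ 2 +
        κ * (inner ℝ x (toEuclideanLin Q x) + inner ℝ u (toEuclideanLin R u)) := by
    intro x u
    -- Output injection: a Schur stable matrix acts on `x`, and the remainder `d` involves only `u`
    -- and `√Q x`, both controlled by the stage cost.
    set a := toEuclideanLin (A + G * psdSqrt Q) x with ha
    set d := toEuclideanLin B u - toEuclideanLin G (toEuclideanLin (psdSqrt Q) x) with hd
    have e : toEuclideanLin A x + toEuclideanLin B u = a + d := by
      rw [ha, hd, map_add, LinearMap.add_apply, toEuclideanLin_mul_apply]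
      abel
    rw [e]
    have h1 := inner_add_toEuclideanLin_add_le hS.posSemidef hε0 a d
    have h2 := hlyap x
    rw [← ha] at h2
    have hq := norm_toEuclideanLin_psdSqrt_sq hQ x
    have hq0 := inner_toEuclideanLin_nonneg hQ x
    have hr0 := inner_toEuclideanLin_nonneg hR.posSemidef u
    have hd2 : ‖d‖ ^ 2 ≤ (2 * g ^ 2 + 2 * b ^ 2 / r) *
        (inner ℝ x (toEuclideanLin Q x) + inner ℝ u (toEuclideanLin R u)) := by
      have i1 : ‖d‖ ≤ b * ‖u‖ + g * ‖toEuclideanLin (psdSqrt Q) x‖ :=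
        (norm_sub_le _ _).trans (add_le_add (hBle u) (hGle _))
      have i2 : ‖d‖ ^ 2 ≤ (b * ‖u‖ + g * ‖toEuclideanLin (psdSqrt Q) x‖) ^ 2 := by gcongr
      have i3 : ‖u‖ ^ 2 ≤ inner ℝ u (toEuclideanLin R u) / r := by
        rw [le_div_iff₀ hr, mul_comm]
        exact hRle u
      have i4 : (b * ‖u‖ + g * ‖toEuclideanLin (psdSqrt Q) x‖) ^ 2 ≤
          2 * b ^ 2 * ‖u‖ ^ 2 + 2 * g ^ 2 * inner ℝ x (toEuclideanLin Q x) := by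
        rw [← hq]
        nlinarith [sq_nonneg (b * ‖u‖ - g * ‖toEuclideanLin (psdSqrt Q) x‖)]
      have i5 : 2 * b ^ 2 * ‖u‖ ^ 2 ≤ 2 * b ^ 2 / r * inner ℝ u (toEuclideanLin R u) := by
        calc 2 * b ^ 2 * ‖u‖ ^ 2 ≤ 2 * b ^ 2 * (inner ℝ u (toEuclideanLin R u) / r) := by gcongr
          _ = _ := by ring
      have i6 : 0 ≤ 2 * b ^ 2 / r * inner ℝ x (toEuclideanLin Q x) := by positivity
      have i7 : 0 ≤ 2 * g ^ 2 * inner ℝ u (toEuclideanLin R u) := by positivity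
      linarith
    have h3 : (1 + ε⁻¹) * inner ℝ d (toEuclideanLin S d) ≤
        κ * (inner ℝ x (toEuclideanLin Q x) + inner ℝ u (toEuclideanLin R u)) := by
      calc (1 + ε⁻¹) * inner ℝ d (toEuclideanLin S d) ≤ (1 + ε⁻¹) * (s * ‖d‖ ^ 2) := by
            gcongr; exact hSle d
        _ ≤ (1 + ε⁻¹) * (s * ((2 * g ^ 2 + 2 * b ^ 2 / r) *
              (inner ℝ x (toEuclideanLin Q x) + inner ℝ u (toEuclideanLin R u)))) := by gcongr
        _ = _ := by rw [hκ]; ring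
    have h4 : ε * inner ℝ a (toEuclideanLin S a) ≤ c / 2 * ‖x‖ ^ 2 := by
      have : inner ℝ a (toEuclideanLin S a) ≤ s * ‖x‖ ^ 2 := by
        have := hSle x
        have : 0 ≤ c * ‖x‖ ^ 2 := by positivity
        linarith
      calc ε * inner ℝ a (toEuclideanLin S a) ≤ ε * (s * ‖x‖ ^ 2) := by gcongr
        _ = c / 2 * ‖x‖ ^ 2 := by rw [hε]; field_simp
    linarith
  refine ⟨κ⁻¹ • S, hS.smul (by positivity), κ⁻¹ * (c / 2), by positivity, fun x u => ?_⟩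
  have h := mul_le_mul_of_nonneg_left (key x u) (inv_nonneg.2 hκ0.le)
  simp only [map_smul, LinearMap.smul_apply, inner_smul_right]
  have e : κ⁻¹ * (inner ℝ x (toEuclideanLin S x) - c / 2 * ‖x‖ ^ 2 +
        κ * (inner ℝ x (toEuclideanLin Q x) + inner ℝ u (toEuclideanLin R u))) =
      κ⁻¹ * inner ℝ x (toEuclideanLin S x) - κ⁻¹ * (c / 2) * ‖x‖ ^ 2 +
        (inner ℝ x (toEuclideanLin Q x) + inner ℝ u (toEuclideanLin R u)) := by
    field_simp
  linarith

end Lyapunov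

/-! ### The Riccati equation -/

section Riccati

variable {n l : ℕ}

/-- The right-hand side of the discrete-time algebraic Riccati equation. -/
noncomputable def riccatiMap (A : Matrix (Fin n) (Fin n) ℝ) (B : Matrix (Fin n) (Fin l) ℝ)
    (Q : Matrix (Fin n) (Fin n) ℝ) (R : Matrix (Fin l) (Fin l) ℝ) (P : Matrix (Fin n) (Fin n) ℝ) :
    Matrix (Fin n) (Fin n) ℝ :=
  Aᵀ * P * A + Q - Aᵀ * P * B * (R + Bᵀ * P * B)⁻¹ * Bᵀ * P * A

/-- The minimizing feedback in the right-hand side of the Riccati equation. -/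
noncomputable def riccatiGain (A : Matrix (Fin n) (Fin n) ℝ) (B : Matrix (Fin n) (Fin l) ℝ)
    (R : Matrix (Fin l) (Fin l) ℝ) (P : Matrix (Fin n) (Fin n) ℝ) : Matrix (Fin l) (Fin n) ℝ :=
  -((R + Bᵀ * P * B)⁻¹ * Bᵀ * P * A)

variable {A : Matrix (Fin n) (Fin n) ℝ} {B : Matrix (Fin n) (Fin l) ℝ}
  {Q : Matrix (Fin n) (Fin n) ℝ} {R : Matrix (Fin l) (Fin l) ℝ} {P : Matrix (Fin n) (Fin n) ℝ}

lemma posSemidef_transpose_mul_mul (hP : P.PosSemidef) (B : Matrix (Fin n) (Fin l) ℝ) :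
    (Bᵀ * P * B).PosSemidef := by
  simpa using hP.conjTranspose_mul_mul_same B

lemma posDef_riccati_weight (hR : R.PosDef) (hP : P.PosSemidef) : (R + Bᵀ * P * B).PosDef :=
  hR.add_posSemidef (posSemidef_transpose_mul_mul hP B)

/-- First-order condition for minimising `uᵀRu + (Ax + Bu)ᵀP(Ax + Bu)` over `u`. Together with
`riccatiMap_eq` it is all that the completion of squares needs to know about the inverse matrix. -/
lemma riccatiGain_stationary (hR : R.PosDef) (hP : P.PosSemidef) :
    R * riccatiGain A B R P + Bᵀ * (P * (A + B * riccatiGain A B R P)) = 0 := by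
  have hu : IsUnit (R + Bᵀ * P * B).det :=
    (Matrix.isUnit_iff_isUnit_det _).1 (posDef_riccati_weight (B := B) hR hP).isUnit
  have h : (R + Bᵀ * P * B) * riccatiGain A B R P = -(Bᵀ * P * A) := by
    rw [riccatiGain, Matrix.mul_neg, Matrix.mul_assoc _ Bᵀ, Matrix.mul_assoc _ (Bᵀ * P),
      Matrix.mul_nonsing_inv_cancel_left _ _ hu]
  calc _ = (R + Bᵀ * P * B) * riccatiGain A B R P + Bᵀ * P * A := by
        simp only [Matrix.add_mul, Matrix.mul_add, Matrix.mul_assoc]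
        abel
    _ = 0 := by rw [h]; simp

lemma riccatiMap_eq : riccatiMap A B Q R P = Q + Aᵀ * (P * (A + B * riccatiGain A B R P)) := by
  simp only [riccatiMap, riccatiGain, Matrix.mul_add, Matrix.mul_neg, Matrix.mul_assoc]
  abel

lemma riccatiGain_inner_stationary (hR : R.PosDef) (hP : P.PosSemidef)
    (v : EuclideanSpace ℝ (Fin l)) (y : EuclideanSpace ℝ (Fin n)) :
    inner ℝ v (toEuclideanLin R (toEuclideanLin (riccatiGain A B R P) y)) +
      inner ℝ (toEuclideanLin B v) (toEuclideanLin P (toEuclideanLin A y +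
        toEuclideanLin B (toEuclideanLin (riccatiGain A B R P) y))) = 0 := by
  have h := congrArg (fun M => inner ℝ v (toEuclideanLin M y))
    (riccatiGain_stationary (A := A) (B := B) hR hP)
  simpa only [map_add, LinearMap.add_apply, inner_add_right, toEuclideanLin_mul_apply,
    inner_toEuclideanLin_transpose, map_zero, LinearMap.zero_apply, inner_zero_right] using h

lemma inner_riccatiMap (x y : EuclideanSpace ℝ (Fin n)) :
    inner ℝ x (toEuclideanLin (riccatiMap A B Q R P) y) =
      inner ℝ x (toEuclideanLin Q y) +
      inner ℝ (toEuclideanLin A x) (toEuclideanLin P (toEuclideanLin A y +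
        toEuclideanLin B (toEuclideanLin (riccatiGain A B R P) y))) := by
  rw [riccatiMap_eq]
  simp only [map_add, LinearMap.add_apply, inner_add_right, toEuclideanLin_mul_apply,
    inner_toEuclideanLin_transpose]

/-- Completion of squares. -/
lemma riccati_completion (hR : R.PosDef) (hP : P.PosSemidef)
    (x : EuclideanSpace ℝ (Fin n)) (u : EuclideanSpace ℝ (Fin l)) :
    inner ℝ x (toEuclideanLin Q x) + inner ℝ u (toEuclideanLin R u) +
        inner ℝ (toEuclideanLin A x + toEuclideanLin B u)
          (toEuclideanLin P (toEuclideanLin A x + toEuclideanLin B u)) =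
      inner ℝ x (toEuclideanLin (riccatiMap A B Q R P) x) +
        inner ℝ (u - toEuclideanLin (riccatiGain A B R P) x)
          (toEuclideanLin (R + Bᵀ * P * B) (u - toEuclideanLin (riccatiGain A B R P) x)) := by
  have h1 := riccatiGain_inner_stationary (A := A) (B := B) hR hP u x
  have h2 := riccatiGain_inner_stationary (A := A) (B := B) hR hP
    (toEuclideanLin (riccatiGain A B R P) x) x
  rw [inner_riccatiMap]
  set k := toEuclideanLin (riccatiGain A B R P) x
  have c1 := inner_toEuclideanLin_comm hR.1 u k
  have c2 := inner_toEuclideanLin_comm hP.1 (toEuclideanLin A x) (toEuclideanLin B u)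
  have c3 := inner_toEuclideanLin_comm hP.1 (toEuclideanLin B u) (toEuclideanLin B k)
  have c4 := inner_toEuclideanLin_comm hP.1 (toEuclideanLin A x) (toEuclideanLin B k)
  simp only [map_add, map_sub, LinearMap.add_apply, inner_add_right, inner_add_left,
    inner_sub_right, inner_sub_left, toEuclideanLin_mul_apply,
    inner_toEuclideanLin_transpose] at h1 h2 ⊢
  linarith

lemma riccatiMap_isHermitian (hQ : Q.IsHermitian) (hR : R.PosDef) (hP : P.PosSemidef) :
    (riccatiMap A B Q R P).IsHermitian := by
  have hi : ((R + Bᵀ * P * B)⁻¹)ᵀ = (R + Bᵀ * P * B)⁻¹ := by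
    rw [← conjTranspose_eq_transpose_of_trivial]
    exact (posDef_riccati_weight hR hP).inv.1
  have hQ' : Qᵀ = Q := by rw [← conjTranspose_eq_transpose_of_trivial, hQ.eq]
  have hP' : Pᵀ = P := by rw [← conjTranspose_eq_transpose_of_trivial, hP.1.eq]
  rw [IsHermitian, conjTranspose_eq_transpose_of_trivial, riccatiMap]
  simp only [transpose_sub, transpose_add, transpose_mul, transpose_transpose, hi, hQ', hP']
  simp only [Matrix.mul_assoc]

lemma riccatiMap_inner_le (hR : R.PosDef) (hP : P.PosSemidef)
    (x : EuclideanSpace ℝ (Fin n)) (u : EuclideanSpace ℝ (Fin l)) :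
    inner ℝ x (toEuclideanLin (riccatiMap A B Q R P) x) ≤
      inner ℝ x (toEuclideanLin Q x) + inner ℝ u (toEuclideanLin R u) +
        inner ℝ (toEuclideanLin A x + toEuclideanLin B u)
          (toEuclideanLin P (toEuclideanLin A x + toEuclideanLin B u)) := by
  rw [riccati_completion hR hP]
  linarith [inner_toEuclideanLin_nonneg (posDef_riccati_weight (B := B) hR hP).posSemidef
    (u - toEuclideanLin (riccatiGain A B R P) x)]

lemma riccatiMap_inner_eq (hR : R.PosDef) (hP : P.PosSemidef) (x : EuclideanSpace ℝ (Fin n)) :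
    inner ℝ x (toEuclideanLin (riccatiMap A B Q R P) x) =
      inner ℝ x (toEuclideanLin Q x) + inner ℝ (toEuclideanLin (riccatiGain A B R P) x)
        (toEuclideanLin R (toEuclideanLin (riccatiGain A B R P) x)) +
        inner ℝ (toEuclideanLin A x + toEuclideanLin B (toEuclideanLin (riccatiGain A B R P) x))
          (toEuclideanLin P (toEuclideanLin A x +
            toEuclideanLin B (toEuclideanLin (riccatiGain A B R P) x))) := by
  rw [riccati_completion hR hP]
  simp

lemma riccatiMap_posSemidef (hQ : Q.PosSemidef) (hR : R.PosDef) (hP : P.PosSemidef) :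
    (riccatiMap A B Q R P).PosSemidef := by
  refine posSemidef_of_inner_nonneg (riccatiMap_isHermitian hQ.1 hR hP) fun x => ?_
  rw [riccatiMap_inner_eq hR hP]
  have h1 := inner_toEuclideanLin_nonneg hQ x
  have h2 := inner_toEuclideanLin_nonneg hR.posSemidef (toEuclideanLin (riccatiGain A B R P) x)
  have h3 := inner_toEuclideanLin_nonneg hP
    (toEuclideanLin A x + toEuclideanLin B (toEuclideanLin (riccatiGain A B R P) x))
  positivity

/-- The form of the Riccati map is a minimum over controls of expressions monotone in `P`: the
minimiser for `P'` is a competitor for `P`. -/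
lemma riccatiMap_inner_mono (hR : R.PosDef) (hP : P.PosSemidef)
    {P' : Matrix (Fin n) (Fin n) ℝ} (hP' : P'.PosSemidef)
    (h : ∀ x, inner ℝ x (toEuclideanLin P x) ≤ inner ℝ x (toEuclideanLin P' x))
    (x : EuclideanSpace ℝ (Fin n)) :
    inner ℝ x (toEuclideanLin (riccatiMap A B Q R P) x) ≤
      inner ℝ x (toEuclideanLin (riccatiMap A B Q R P') x) := by
  rw [riccatiMap_inner_eq hR hP']
  refine (riccatiMap_inner_le hR hP x (toEuclideanLin (riccatiGain A B R P') x)).trans ?_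
  gcongr
  exact h _

/-- A stabilizing feedback bounds the value iteration. -/
lemma IsStabilizable.exists_supersolution (hstab : IsStabilizable A B)
    (Q : Matrix (Fin n) (Fin n) ℝ) (R : Matrix (Fin l) (Fin l) ℝ) :
    ∃ (S : Matrix (Fin n) (Fin n) ℝ) (F : Matrix (Fin l) (Fin n) ℝ), S.PosSemidef ∧ ∀ x,
      inner ℝ x (toEuclideanLin Q x) +
        inner ℝ (toEuclideanLin F x) (toEuclideanLin R (toEuclideanLin F x)) +
        inner ℝ (toEuclideanLin A x + toEuclideanLin B (toEuclideanLin F x))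
          (toEuclideanLin S (toEuclideanLin A x + toEuclideanLin B (toEuclideanLin F x))) ≤
      inner ℝ x (toEuclideanLin S x) := by
  obtain ⟨F, hF⟩ := hstab
  obtain ⟨S, hS, c, hc, hlyap⟩ := hF.exists_lyapunov
  obtain ⟨C, hC, hle⟩ := exists_inner_toEuclideanLin_le (Q + Fᵀ * R * F)
  -- `C` bounds the one-step cost of the feedback and `c` is the Lyapunov decrease, so this scaling
  -- makes the decrease dominate the cost.
  refine ⟨(C / c) • S, F, hS.posSemidef.smul (by positivity), fun x => ?_⟩
  have h1 := hlyap x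
  have h2 := hle x
  simp only [map_add, LinearMap.add_apply, inner_add_right, toEuclideanLin_mul_apply,
    inner_toEuclideanLin_transpose] at h1 h2
  have h3 := mul_le_mul_of_nonneg_left h1 (show 0 ≤ C / c by positivity)
  simp only [map_smul, LinearMap.smul_apply, inner_smul_right, map_add, inner_add_right] at h3 ⊢
  have e : C / c * (c * ‖x‖ ^ 2) = C * ‖x‖ ^ 2 := by field_simp
  linarith

/-- Polarisation recovers entries from the quadratic form, so that convergence of forms gives
convergence of matrices. -/
lemma apply_eq_polarization (hP : P.IsHermitian) (i j : Fin n) :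
    P i j = (inner ℝ (EuclideanSpace.single i (1 : ℝ) + EuclideanSpace.single j 1)
        (toEuclideanLin P (EuclideanSpace.single i (1 : ℝ) + EuclideanSpace.single j 1)) -
      inner ℝ (EuclideanSpace.single i (1 : ℝ) - EuclideanSpace.single j 1)
        (toEuclideanLin P (EuclideanSpace.single i (1 : ℝ) - EuclideanSpace.single j 1))) / 4 := by
  have h := inner_toEuclideanLin_comm hP (EuclideanSpace.single i (1 : ℝ))
    (EuclideanSpace.single j (1 : ℝ))
  have e : inner ℝ (EuclideanSpace.single i (1 : ℝ))
      (toEuclideanLin P (EuclideanSpace.single j (1 : ℝ))) = P i j := by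
    simp [EuclideanSpace.inner_single_left]
  simp only [map_add, map_sub, inner_add_left, inner_add_right, inner_sub_left,
    inner_sub_right]
  linarith

lemma tendsto_matrix_mul {ι : Type*} {f : Filter ι} {a b c : ℕ}
    {M : ι → Matrix (Fin a) (Fin b) ℝ} {N : ι → Matrix (Fin b) (Fin c) ℝ}
    {M₀ : Matrix (Fin a) (Fin b) ℝ} {N₀ : Matrix (Fin b) (Fin c) ℝ}
    (hM : Filter.Tendsto M f (nhds M₀)) (hN : Filter.Tendsto N f (nhds N₀)) :
    Filter.Tendsto (fun i => M i * N i) f (nhds (M₀ * N₀)) := by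
  have hc : Continuous fun z : Matrix (Fin a) (Fin b) ℝ × Matrix (Fin b) (Fin c) ℝ => z.1 * z.2 :=
    continuous_fst.matrix_mul continuous_snd
  exact (hc.tendsto (M₀, N₀)).comp (hM.prodMk_nhds hN)

lemma tendsto_riccatiMap {ι : Type*} {f : Filter ι} {p : ι → Matrix (Fin n) (Fin n) ℝ}
    (hR : R.PosDef) (hP : P.PosSemidef) (h : Filter.Tendsto p f (nhds P)) :
    Filter.Tendsto (fun k => riccatiMap A B Q R (p k)) f (nhds (riccatiMap A B Q R P)) := by
  have hH : Filter.Tendsto (fun k => R + Bᵀ * p k * B) f (nhds (R + Bᵀ * P * B)) :=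
    tendsto_const_nhds.add
      (tendsto_matrix_mul (tendsto_matrix_mul tendsto_const_nhds h) tendsto_const_nhds)
  have hdet : (R + Bᵀ * P * B).det ≠ 0 := (posDef_riccati_weight hR hP).det_pos.ne'
  have hring : ContinuousAt Ring.inverse (R + Bᵀ * P * B).det := by
    rw [Ring.inverse_eq_inv']
    exact continuousAt_inv₀ hdet
  have hinv : Filter.Tendsto (fun k => (R + Bᵀ * p k * B)⁻¹) f (nhds (R + Bᵀ * P * B)⁻¹) :=
    (continuousAt_matrix_inv (R + Bᵀ * P * B) hring).tendsto.comp hH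
  have h1 : Filter.Tendsto (fun k => Aᵀ * p k) f (nhds (Aᵀ * P)) :=
    tendsto_matrix_mul tendsto_const_nhds h
  have h2 : Filter.Tendsto (fun k => Aᵀ * p k * B) f (nhds (Aᵀ * P * B)) :=
    tendsto_matrix_mul h1 tendsto_const_nhds
  unfold riccatiMap
  refine ((tendsto_matrix_mul h1 tendsto_const_nhds).add tendsto_const_nhds).sub ?_
  refine tendsto_matrix_mul (tendsto_matrix_mul ?_ h) tendsto_const_nhds
  exact tendsto_matrix_mul (tendsto_matrix_mul h2 hinv) tendsto_const_nhds

/-- A sequence of positive semidefinite matrices whose quadratic forms increase and are bounded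
converges to a positive semidefinite matrix. -/
lemma exists_tendsto_of_monotone_of_bounded {p : ℕ → Matrix (Fin n) (Fin n) ℝ}
    (hpsd : ∀ k, (p k).PosSemidef)
    (hmono : ∀ k x, inner ℝ x (toEuclideanLin (p k) x) ≤ inner ℝ x (toEuclideanLin (p (k + 1)) x))
    {S : Matrix (Fin n) (Fin n) ℝ}
    (hbdd : ∀ k x, inner ℝ x (toEuclideanLin (p k) x) ≤ inner ℝ x (toEuclideanLin S x)) :
    ∃ P : Matrix (Fin n) (Fin n) ℝ, P.PosSemidef ∧ Filter.Tendsto p Filter.atTop (nhds P) := by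
  have hlim : ∀ x, ∃ a, Filter.Tendsto (fun k => inner ℝ x (toEuclideanLin (p k) x))
      Filter.atTop (nhds a) := fun x =>
    ⟨_, tendsto_atTop_ciSup (monotone_nat_of_le_succ fun k => hmono k x)
      ⟨inner ℝ x (toEuclideanLin S x), by rintro _ ⟨k, rfl⟩; exact hbdd k x⟩⟩
  choose q hq using hlim
  have hentry : ∀ i j, ∃ a, Filter.Tendsto (fun k => p k i j) Filter.atTop (nhds a) := fun i j => by
    simp_rw [fun k => apply_eq_polarization (hpsd k).1 i j]
    exact ⟨_, ((hq _).sub (hq _)).div_const 4⟩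
  choose P hP using hentry
  have hPt : Filter.Tendsto p Filter.atTop (nhds (Matrix.of P)) :=
    tendsto_pi_nhds.2 fun i => tendsto_pi_nhds.2 fun j => hP i j
  have hherm : (Matrix.of P).IsHermitian := by
    ext i j
    have h : Filter.Tendsto (fun k => p k j i) Filter.atTop (nhds (P i j)) := by
      refine (hP i j).congr fun k => ?_
      simpa using ((hpsd k).1.apply i j).symm
    simpa using tendsto_nhds_unique (hP j i) h
  refine ⟨Matrix.of P, posSemidef_of_inner_nonneg hherm fun x => ?_, hPt⟩
  have hc : Continuous fun M : Matrix (Fin n) (Fin n) ℝ => inner ℝ x (toEuclideanLin M x) := by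
    simp_rw [inner_toEuclideanLin_eq_dotProduct]
    exact continuous_const.dotProduct (continuous_id.matrix_mulVec continuous_const)
  exact ge_of_tendsto' ((hc.tendsto _).comp hPt) fun k => inner_toEuclideanLin_nonneg (hpsd k) x

/-- Existence of a positive semidefinite solution of the Riccati equation. -/
lemma IsStabilizable.exists_riccati (hstab : IsStabilizable A B) (hQ : Q.PosSemidef)
    (hR : R.PosDef) : ∃ P : Matrix (Fin n) (Fin n) ℝ, P.PosSemidef ∧ P = riccatiMap A B Q R P := by
  obtain ⟨S, F, hS, hsup⟩ := hstab.exists_supersolution Q R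
  -- Value iteration from zero terminal cost. It increases because its first iterate is nonnegative
  -- and the map is monotone; it stays below `S` because the stabilising feedback `F` is a
  -- competitor at every step.
  obtain ⟨p, hzero, hsucc⟩ : ∃ p : ℕ → Matrix (Fin n) (Fin n) ℝ,
      p 0 = 0 ∧ ∀ k, p (k + 1) = riccatiMap A B Q R (p k) :=
    ⟨fun k => (riccatiMap A B Q R)^[k] 0, rfl, fun k => Function.iterate_succ_apply' _ _ _⟩
  have hpsd : ∀ k, (p k).PosSemidef := fun k => by
    induction k with
    | zero => rw [hzero]; exact Matrix.PosSemidef.zero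
    | succ k ih => rw [hsucc]; exact riccatiMap_posSemidef hQ hR ih
  have hmono : ∀ k x, inner ℝ x (toEuclideanLin (p k) x) ≤
      inner ℝ x (toEuclideanLin (p (k + 1)) x) := fun k => by
    induction k with
    | zero =>
      intro x
      simpa [hzero] using inner_toEuclideanLin_nonneg (hpsd 1) x
    | succ k ih =>
      intro x
      rw [hsucc (k + 1)]
      nth_rewrite 1 [hsucc k]
      exact riccatiMap_inner_mono hR (hpsd _) (hpsd _) ih x
  have hbdd : ∀ k x, inner ℝ x (toEuclideanLin (p k) x) ≤ inner ℝ x (toEuclideanLin S x) := by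
    intro k
    induction k with
    | zero =>
      intro x
      simpa [hzero] using inner_toEuclideanLin_nonneg hS x
    | succ k ih =>
      intro x
      rw [hsucc]
      refine (riccatiMap_inner_le hR (hpsd k) x (toEuclideanLin F x)).trans
        (le_trans ?_ (hsup x))
      gcongr
      exact ih _
  obtain ⟨P, hP, hlim⟩ := exists_tendsto_of_monotone_of_bounded hpsd hmono hbdd
  refine ⟨P, hP, tendsto_nhds_unique ((Filter.tendsto_add_atTop_iff_nat 1).2 hlim) ?_⟩
  simp_rw [hsucc]
  exact tendsto_riccatiMap hR hP hlim

/-- The closed loop of the Riccati feedback is exponentially stable if the state weight is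
detectable. -/
lemma exists_norm_pow_closedLoop_le {S : Matrix (Fin n) (Fin n) ℝ} (hR : R.PosDef)
    (hP : P.PosSemidef) (hric : P = riccatiMap A B Q R P) (hS : S.PosDef) {c : ℝ} (hc : 0 < c)
    (hdiss : ∀ x u, c * ‖x‖ ^ 2 ≤ inner ℝ x (toEuclideanLin Q x) + inner ℝ u (toEuclideanLin R u)
        + inner ℝ x (toEuclideanLin S x)
        - inner ℝ (toEuclideanLin A x + toEuclideanLin B u)
          (toEuclideanLin S (toEuclideanLin A x + toEuclideanLin B u))) :
    ∃ C r : ℝ, 0 ≤ C ∧ 0 ≤ r ∧ r < 1 ∧ ∀ (k : ℕ) x,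
      ‖toEuclideanLin ((A + B * riccatiGain A B R P) ^ k) x‖ ≤ C * r ^ k * ‖x‖ := by
  set M := A + B * riccatiGain A B R P with hM
  have hT : (P + S).PosDef := hS.posSemidef_add hP
  -- Along the closed loop the form of `P` drops by exactly the stage cost, while that of `S` grows
  -- by at most the stage cost minus `c‖x‖²`. The stage cost cancels in the sum.
  have hstep : ∀ x, inner ℝ (toEuclideanLin M x) (toEuclideanLin (P + S) (toEuclideanLin M x)) ≤
      inner ℝ x (toEuclideanLin (P + S) x) - c * ‖x‖ ^ 2 := fun x => by
    have e : toEuclideanLin M x =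
        toEuclideanLin A x + toEuclideanLin B (toEuclideanLin (riccatiGain A B R P) x) := by
      rw [hM, map_add, LinearMap.add_apply, toEuclideanLin_mul_apply]
    have h1 := riccatiMap_inner_eq (A := A) (B := B) (Q := Q) hR hP x
    rw [← hric] at h1
    have h2 := hdiss x (toEuclideanLin (riccatiGain A B R P) x)
    rw [← e] at h1 h2
    simp only [map_add, LinearMap.add_apply, inner_add_right]
    linarith
  obtain ⟨a, ha, hTa⟩ := exists_le_inner_toEuclideanLin hT
  obtain ⟨b, hb, hTb⟩ := exists_inner_toEuclideanLin_le (P + S)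
  -- Unlike `1 - c / b`, this contraction factor lies in `[0, 1)` without comparing `b` and `c`.
  set ρ := b / (b + c) with hρ
  have hρ0 : 0 ≤ ρ := by positivity
  have hρ1 : ρ < 1 := by rw [hρ, div_lt_one (by positivity)]; linarith
  have hcontr : ∀ x, inner ℝ (toEuclideanLin M x) (toEuclideanLin (P + S) (toEuclideanLin M x)) ≤
      ρ * inner ℝ x (toEuclideanLin (P + S) x) := fun x => by
    have h0 := inner_toEuclideanLin_nonneg hT.posSemidef (toEuclideanLin M x)
    have h1 := hstep x
    have h2 := hTb x
    set t' := inner ℝ (toEuclideanLin M x) (toEuclideanLin (P + S) (toEuclideanLin M x))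
    set t := inner ℝ x (toEuclideanLin (P + S) x)
    rw [hρ, div_mul_eq_mul_div, le_div_iff₀ (by positivity)]
    have : t' ≤ t := by nlinarith [sq_nonneg ‖x‖]
    nlinarith
  have hpow : ∀ (k : ℕ) x, inner ℝ (toEuclideanLin (M ^ k) x)
      (toEuclideanLin (P + S) (toEuclideanLin (M ^ k) x)) ≤
      ρ ^ k * inner ℝ x (toEuclideanLin (P + S) x) := fun k => by
    induction k with
    | zero => intro x; simp
    | succ k ih =>
      intro x
      rw [pow_succ' M, toEuclideanLin_mul_apply, pow_succ' ρ, mul_assoc]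
      exact (hcontr _).trans (by gcongr; exact ih x)
  refine ⟨√(b / a), √ρ, by positivity, by positivity, ?_, fun k x => ?_⟩
  · rw [Real.sqrt_lt' one_pos]; simpa using hρ1
  · have h : ‖toEuclideanLin (M ^ k) x‖ ^ 2 ≤ (√(b / a) * √ρ ^ k * ‖x‖) ^ 2 := by
      rw [mul_pow, mul_pow, ← pow_mul, mul_comm k 2, pow_mul, Real.sq_sqrt (by positivity),
        Real.sq_sqrt hρ0]
      have h1 := (hTa (toEuclideanLin (M ^ k) x)).trans (hpow k x)
      have h2 : ρ ^ k * inner ℝ x (toEuclideanLin (P + S) x) ≤ ρ ^ k * (b * ‖x‖ ^ 2) := by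
        gcongr; exact hTb x
      rw [div_mul_eq_mul_div, div_mul_eq_mul_div, le_div_iff₀ ha]
      linarith
    exact (sq_le_sq₀ (norm_nonneg _) (by positivity)).1 h

end Riccati

/-! ### Optimal steady states -/

namespace LQProblem

variable {n l m : ℕ} (p : LQProblem n l m)

/-- The polar form of the quadratic part of the deterministic stage cost. -/
noncomputable def costForm :
    LinearMap.BilinForm ℝ (EuclideanSpace ℝ (Fin n) × EuclideanSpace ℝ (Fin l)) :=
  LinearMap.mk₂ ℝ (fun h h' => inner ℝ h.1 (toEuclideanLin p.Q₁ h'.1) +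
      inner ℝ h.2 (toEuclideanLin p.R₁ h'.2))
    (fun a b c => by simp only [Prod.fst_add, Prod.snd_add, inner_add_left]; ring)
    (fun r a b => by
      simp only [Prod.smul_fst, Prod.smul_snd, inner_smul_left, conj_trivial, smul_eq_mul]; ring)
    (fun a b c => by simp only [Prod.fst_add, Prod.snd_add, map_add, inner_add_right]; ring)
    (fun r a b => by
      simp only [Prod.smul_fst, Prod.smul_snd, map_smul, inner_smul_right, smul_eq_mul]; ring)

lemma costForm_apply (h h' : EuclideanSpace ℝ (Fin n) × EuclideanSpace ℝ (Fin l)) :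
    p.costForm h h' = inner ℝ h.1 (toEuclideanLin p.Q₁ h'.1) +
      inner ℝ h.2 (toEuclideanLin p.R₁ h'.2) := rfl

/-- The linear part `(x, u) ↦ sᵀ x + vᵀ u` of the deterministic stage cost. -/
noncomputable def costLin : EuclideanSpace ℝ (Fin n) × EuclideanSpace ℝ (Fin l) →ₗ[ℝ] ℝ :=
  (innerₗ _ p.s).coprod (innerₗ _ p.v)

lemma costLin_apply (h : EuclideanSpace ℝ (Fin n) × EuclideanSpace ℝ (Fin l)) :
    p.costLin h = inner ℝ p.s h.1 + inner ℝ p.v h.2 := rfl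

/-- The linear map `(x, u) ↦ x - A x - B u` whose level sets are the sets of steady states. -/
noncomputable def steadyMap :
    EuclideanSpace ℝ (Fin n) × EuclideanSpace ℝ (Fin l) →ₗ[ℝ] EuclideanSpace ℝ (Fin n) :=
  (LinearMap.id - toEuclideanLin p.A).coprod (-toEuclideanLin p.B)

lemma steadyMap_apply (h : EuclideanSpace ℝ (Fin n) × EuclideanSpace ℝ (Fin l)) :
    p.steadyMap h = h.1 - (toEuclideanLin p.A h.1 + toEuclideanLin p.B h.2) := by
  simp only [steadyMap, LinearMap.coprod_apply, LinearMap.sub_apply, LinearMap.id_apply,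
    LinearMap.neg_apply]
  abel

lemma isSteadyState_iff (w : EuclideanSpace ℝ (Fin m)) (x : EuclideanSpace ℝ (Fin n))
    (u : EuclideanSpace ℝ (Fin l)) :
    p.IsSteadyState w x u ↔ p.steadyMap (x, u) = toEuclideanLin p.E w + p.z := by
  rw [IsSteadyState, f, steadyMap_apply, sub_eq_iff_eq_add]
  have e : toEuclideanLin p.A x + toEuclideanLin p.B u + toEuclideanLin p.E w + p.z =
      toEuclideanLin p.E w + p.z + (toEuclideanLin p.A x + toEuclideanLin p.B u) := by abel
  rw [e]

lemma detStageCost_eq (h : EuclideanSpace ℝ (Fin n) × EuclideanSpace ℝ (Fin l)) :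
    p.detStageCost h.1 h.2 = p.costForm h h + p.costLin h + p.c := by
  rw [costForm_apply, costLin_apply, detStageCost]
  ring

variable {p}

/-- Existence of an optimal steady state together with a Lagrange multiplier. -/
lemma exists_optimalSteadyState (hQ₁ : p.Q₁.PosSemidef) (hR₁ : p.R₁.PosDef)
    {S : Matrix (Fin n) (Fin n) ℝ} {c : ℝ} (hc : 0 < c)
    (hdiss : ∀ x u, c * ‖x‖ ^ 2 ≤
        inner ℝ x (toEuclideanLin p.Q₁ x) + inner ℝ u (toEuclideanLin p.R₁ u)
        + inner ℝ x (toEuclideanLin S x)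
        - inner ℝ (toEuclideanLin p.A x + toEuclideanLin p.B u)
          (toEuclideanLin S (toEuclideanLin p.A x + toEuclideanLin p.B u)))
    {w : EuclideanSpace ℝ (Fin m)} (hsteady : ∃ xs us, p.IsSteadyState w xs us) :
    ∃ xe ue ν, p.IsOptimalSteadyState w xe ue ∧ ∀ d v,
      2 * inner ℝ d (toEuclideanLin p.Q₁ xe) + inner ℝ p.s d +
        (2 * inner ℝ v (toEuclideanLin p.R₁ ue) + inner ℝ p.v v) + inner ℝ ν d
        - inner ℝ ν (toEuclideanLin p.A d + toEuclideanLin p.B v) = 0 := by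
  obtain ⟨xs, us, hs⟩ := hsteady
  set V := LinearMap.ker p.steadyMap with hV
  have hsymm : ∀ h h', p.costForm h h' = p.costForm h' h := fun h h' => by
    rw [costForm_apply, costForm_apply, inner_toEuclideanLin_comm hQ₁.1,
      inner_toEuclideanLin_comm hR₁.1]
  have hnonneg : ∀ h, 0 ≤ p.costForm h h := fun h =>
    add_nonneg (inner_toEuclideanLin_nonneg hQ₁ _) (inner_toEuclideanLin_nonneg hR₁.posSemidef _)
  -- For a steady direction `x = Ax + Bu`, so the two `S`-terms cancel and the cost form alone
  -- dominates `c‖x‖²`; then `R₁ > 0` forces `u = 0`.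
  have hpos : ∀ h ∈ V, p.costForm h h = 0 → h = 0 := by
    rintro ⟨x, u⟩ hh h0
    rw [hV, LinearMap.mem_ker, steadyMap_apply, sub_eq_zero] at hh
    have h1 := hdiss x u
    rw [← hh] at h1
    rw [costForm_apply] at h0
    have hx : x = 0 := by
      have : c * ‖x‖ ^ 2 ≤ 0 := by linarith
      have : ‖x‖ ^ 2 ≤ 0 := by nlinarith
      simpa using le_antisymm this (sq_nonneg _)
    have hu : u = 0 := by
      by_contra hu
      have := inner_toEuclideanLin_pos hR₁ hu
      simp [hx] at h0
      linarith
    simp [hx, hu]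
  let φ : V →ₗ[ℝ] Module.Dual ℝ V := p.costForm.domRestrict₁₂ V V
  have hφ : ∀ h h' : V, φ h h' = p.costForm h h' := fun _ _ => rfl
  have hinj : Function.Injective φ := by
    rw [← LinearMap.ker_eq_bot, LinearMap.ker_eq_bot']
    intro h hh
    exact Subtype.ext (hpos h h.2 (by rw [← hφ, hh]; rfl))
  have hsurj : Function.Surjective φ :=
    (LinearMap.injective_iff_surjective_of_finrank_eq_finrank
      (Subspace.dual_finrank_eq (K := ℝ) (V := V)).symm).1 hinj
  -- The derivative of the cost at the given steady state. Moving by `h₁ ∈ V` adds `2 φ h₁` on `V`,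
  -- so solving `φ h₁ = -g₀ / 2` makes the derivative `g` at `e` vanish on `V`.
  let g₀ : EuclideanSpace ℝ (Fin n) × EuclideanSpace ℝ (Fin l) →ₗ[ℝ] ℝ :=
    (2 : ℝ) • p.costForm (xs, us) + p.costLin
  obtain ⟨h₁, hh₁⟩ := hsurj (-(1 / 2 : ℝ) • g₀.domRestrict V)
  set e : EuclideanSpace ℝ (Fin n) × EuclideanSpace ℝ (Fin l) := (xs, us) + h₁ with he
  let g : EuclideanSpace ℝ (Fin n) × EuclideanSpace ℝ (Fin l) →ₗ[ℝ] ℝ :=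
    (2 : ℝ) • p.costForm e + p.costLin
  have hg : ∀ h ∈ V, g h = 0 := fun h hh => by
    have := LinearMap.congr_fun hh₁ ⟨h, hh⟩
    rw [hφ] at this
    simp only [LinearMap.smul_apply, LinearMap.domRestrict_apply, g₀, LinearMap.add_apply,
      smul_eq_mul] at this
    simp only [g, he, map_add, LinearMap.smul_apply, LinearMap.add_apply, smul_eq_mul]
    linarith
  -- A functional that vanishes on the kernel factors through `steadyMap`; the factor is the
  -- multiplier up to sign.
  have hgr : g ∈ LinearMap.range p.steadyMap.dualMap := by
    rw [LinearMap.range_dualMap_eq_dualAnnihilator_ker, Submodule.mem_dualAnnihilator]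
    exact hg
  obtain ⟨ψ, hψ⟩ := hgr
  set ν := (InnerProductSpace.toDual ℝ (EuclideanSpace ℝ (Fin n))).symm
    (LinearMap.toContinuousLinearMap ψ) with hν
  have hνψ : ∀ y, inner ℝ ν y = ψ y := fun y => by
    rw [hν, InnerProductSpace.toDual_symm_apply]
    rfl
  have hes : p.steadyMap e = toEuclideanLin p.E w + p.z := by
    rw [he, map_add, LinearMap.mem_ker.1 h₁.2, add_zero]
    exact (p.isSteadyState_iff w xs us).1 hs
  refine ⟨e.1, e.2, -ν, ⟨(p.isSteadyState_iff w e.1 e.2).2 hes, fun x' u' h' => ?_⟩,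
    fun d v => ?_⟩
  -- With `d = (x', u') - e`, the cost difference is `g d + costForm d d`; the first term is zero
  -- and the second nonnegative.
  · have hd : (x', u') - e ∈ V := by
      rw [hV, LinearMap.mem_ker, map_sub, (p.isSteadyState_iff w x' u').1 h', hes, sub_self]
    have h1 := hg _ hd
    have h2 := hnonneg ((x', u') - e)
    have h3 := hsymm e (x', u')
    have h4 := p.detStageCost_eq e
    have h5 := p.detStageCost_eq (x', u')
    simp only [g, LinearMap.add_apply, LinearMap.smul_apply, map_sub, LinearMap.sub_apply,
      smul_eq_mul] at h1 h2
    simp only at h5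
    linarith
  · have h1 : g (d, v) = ψ (p.steadyMap (d, v)) := by rw [← hψ]; rfl
    rw [← hνψ, steadyMap_apply, inner_sub_right] at h1
    simp only [g, LinearMap.add_apply, LinearMap.smul_apply, smul_eq_mul, costForm_apply,
      costLin_apply] at h1
    rw [inner_toEuclideanLin_comm hQ₁.1 d, inner_toEuclideanLin_comm hR₁.1 v, inner_neg_left,
      inner_neg_left]
    linarith

end LQProblem

/-! ### Square-integrable random vectors -/

section L2

variable {n l m : ℕ} {Ω : Type*} [MeasurableSpace Ω] {μ : Measure Ω}

lemma memLp_toEuclideanLin (M : Matrix (Fin n) (Fin m) ℝ) {X : Ω → EuclideanSpace ℝ (Fin m)}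
    {q : ENNReal} (hX : MemLp X q μ) : MemLp (fun ω => toEuclideanLin M (X ω)) q μ :=
  (LinearMap.toContinuousLinearMap (toEuclideanLin M)).comp_memLp' hX

lemma integral_toEuclideanLin (M : Matrix (Fin n) (Fin m) ℝ) {X : Ω → EuclideanSpace ℝ (Fin m)}
    (hX : Integrable X μ) : ∫ ω, toEuclideanLin M (X ω) ∂μ = toEuclideanLin M (∫ ω, X ω ∂μ) :=
  (LinearMap.toContinuousLinearMap (toEuclideanLin M)).integral_comp_comm hX

lemma integrable_inner_of_memLp {X Y : Ω → EuclideanSpace ℝ (Fin n)} (hX : MemLp X 2 μ)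
    (hY : MemLp Y 2 μ) : Integrable (fun ω => inner ℝ (X ω) (Y ω)) μ := by
  refine Integrable.mono' (hX.norm.integrable_mul hY.norm)
    (hX.aestronglyMeasurable.inner hY.aestronglyMeasurable) (ae_of_all _ fun ω => ?_)
  exact norm_inner_le_norm _ _

lemma integrable_inner_toEuclideanLin (M : Matrix (Fin n) (Fin m) ℝ)
    {X : Ω → EuclideanSpace ℝ (Fin n)} {Y : Ω → EuclideanSpace ℝ (Fin m)} (hX : MemLp X 2 μ)
    (hY : MemLp Y 2 μ) : Integrable (fun ω => inner ℝ (X ω) (toEuclideanLin M (Y ω))) μ :=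
  integrable_inner_of_memLp hX (memLp_toEuclideanLin M hY)

variable [IsProbabilityMeasure μ]

lemma trace_mul_covMatrix {Q : Matrix (Fin n) (Fin n) ℝ} {X : Ω → EuclideanSpace ℝ (Fin n)}
    (hX : MemLp X 2 μ) : (Q * covMatrix μ X).trace =
      ∫ ω, inner ℝ (X ω - ∫ ω', X ω' ∂μ) (toEuclideanLin Q (X ω - ∫ ω', X ω' ∂μ)) ∂μ := by
  have hXi : ∀ i, MemLp (fun ω => X ω i) 2 μ := fun i => hX.eval_piLp i
  have hint : ∀ i j, Integrable
      (fun ω => (X ω i - ∫ ω', X ω' i ∂μ) * (X ω j - ∫ ω', X ω' j ∂μ)) μ := fun i j =>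
    ((hXi i).sub (memLp_const _)).integrable_mul ((hXi j).sub (memLp_const _))
  have hev : ∀ i, (∫ ω', X ω' ∂μ) i = ∫ ω', X ω' i ∂μ := fun i =>
    eval_integral_piLp (fun i => (hXi i).integrable one_le_two) i
  have e : ∀ ω, inner ℝ (X ω - ∫ ω', X ω' ∂μ) (toEuclideanLin Q (X ω - ∫ ω', X ω' ∂μ)) =
      ∑ i, ∑ j, Q i j * ((X ω j - ∫ ω', X ω' j ∂μ) * (X ω i - ∫ ω', X ω' i ∂μ)) := fun ω => by
    rw [inner_toEuclideanLin_eq_dotProduct]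
    simp only [dotProduct, mulVec, WithLp.ofLp_sub, Pi.sub_apply, hev, Finset.mul_sum]
    exact Finset.sum_congr rfl fun i _ => Finset.sum_congr rfl fun j _ => by ring
  simp_rw [e]
  rw [integral_finsetSum _ fun i _ =>
    integrable_finsetSum _ fun j _ => (hint j i).const_mul (Q i j)]
  simp only [Matrix.trace, Matrix.diag, Matrix.mul_apply]
  refine Finset.sum_congr rfl fun i _ => ?_
  rw [integral_finsetSum _ fun j _ => (hint j i).const_mul (Q i j)]
  refine Finset.sum_congr rfl fun j _ => ?_
  rw [integral_const_mul]
  rfl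

/-- Convexity of the covariance trace: the left side is its derivative at `Y` in direction `X - Y`,
and the gap is the integral of the `Q`-form of the centred difference. -/
lemma le_trace_mul_covMatrix_sub {Q : Matrix (Fin n) (Fin n) ℝ} (hQ : Q.PosSemidef)
    {X Y : Ω → EuclideanSpace ℝ (Fin n)} (hX : MemLp X 2 μ) (hY : MemLp Y 2 μ) :
    ∫ ω, 2 * inner ℝ (X ω - Y ω) (toEuclideanLin Q (Y ω - ∫ ω', Y ω' ∂μ)) ∂μ ≤
      (Q * covMatrix μ X).trace - (Q * covMatrix μ Y).trace := by
  rw [trace_mul_covMatrix hX, trace_mul_covMatrix hY]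
  set x := ∫ ω', X ω' ∂μ
  set y := ∫ ω', Y ω' ∂μ with hy
  have hX' : MemLp (fun ω => X ω - x) 2 μ := hX.sub (memLp_const _)
  have hY' : MemLp (fun ω => Y ω - y) 2 μ := hY.sub (memLp_const _)
  have hD : MemLp (fun ω => X ω - Y ω) 2 μ := hX.sub hY
  -- The shift of the means pairs with a centred variable, so `X - Y` itself need not be centred.
  have hzero : ∫ ω, inner ℝ (x - y) (toEuclideanLin Q (Y ω - y)) ∂μ = 0 := by
    rw [integral_inner ((memLp_toEuclideanLin Q hY').integrable one_le_two),
      integral_toEuclideanLin Q (hY'.integrable one_le_two),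
      integral_sub (hY.integrable one_le_two) (integrable_const _)]
    simp [hy]
  rw [← integral_sub (integrable_inner_toEuclideanLin Q hX' hX')
    (integrable_inner_toEuclideanLin Q hY' hY')]
  have i1 := (integrable_inner_toEuclideanLin Q hD hY').const_mul 2
  have i2 := (integrable_inner_toEuclideanLin Q (memLp_const (μ := μ) (x - y)) hY').const_mul 2
  calc _ = ∫ ω, (2 * inner ℝ (X ω - Y ω) (toEuclideanLin Q (Y ω - y)) -
        2 * inner ℝ (x - y) (toEuclideanLin Q (Y ω - y))) ∂μ := by
        rw [integral_sub i1 i2, integral_const_mul 2 (fun ω => inner ℝ (x - y) _), hzero]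
        simp
    _ ≤ _ := by
      refine integral_mono (i1.sub i2) ((integrable_inner_toEuclideanLin Q hX' hX').sub
        (integrable_inner_toEuclideanLin Q hY' hY')) fun ω => ?_
      have h := inner_toEuclideanLin_nonneg hQ ((X ω - x) - (Y ω - y))
      have hc := inner_toEuclideanLin_comm hQ.1 (X ω - x) (Y ω - y)
      have e : inner ℝ (X ω - Y ω) (toEuclideanLin Q (Y ω - y)) -
          inner ℝ (x - y) (toEuclideanLin Q (Y ω - y)) =
          inner ℝ (X ω - x) (toEuclideanLin Q (Y ω - y)) -
            inner ℝ (Y ω - y) (toEuclideanLin Q (Y ω - y)) := by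
        rw [← inner_sub_left, ← inner_sub_left]
        congr 1
        abel
      rw [map_sub, inner_sub_left, inner_sub_right, inner_sub_right] at h
      simp only
      linarith

lemma integral_inner_centered_eq_zero {q : ℕ} (M : Matrix (Fin q) (Fin n) ℝ)
    (N : Matrix (Fin q) (Fin m) ℝ) {Z : Ω → EuclideanSpace ℝ (Fin n)}
    {W : Ω → EuclideanSpace ℝ (Fin m)} (hZ : MemLp Z 2 μ) (hW : MemLp W 2 μ)
    (h : IndepFun Z W μ) :
    ∫ ω, inner ℝ (toEuclideanLin M (Z ω)) (toEuclideanLin N (W ω - ∫ ω', W ω' ∂μ)) ∂μ = 0 := by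
  set w := ∫ ω', W ω' ∂μ with hw
  have hi : IndepFun (fun ω => toEuclideanLin M (Z ω)) (fun ω => toEuclideanLin N (W ω - w)) μ :=
    h.comp (φ := fun z => toEuclideanLin M z) (ψ := fun x => toEuclideanLin N (x - w))
      (LinearMap.continuous_of_finiteDimensional _).measurable
      ((LinearMap.continuous_of_finiteDimensional _).measurable.comp (measurable_id.sub_const w))
  have hW' : Integrable (fun ω => W ω - w) μ :=
    (hW.sub (memLp_const w)).integrable one_le_two
  have hW'' : Integrable (fun ω => toEuclideanLin N (W ω - w)) μ :=
    (memLp_toEuclideanLin N (hW.sub (memLp_const w))).integrable one_le_two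
  have hprod : ∫ ω, inner ℝ (toEuclideanLin M (Z ω)) (toEuclideanLin N (W ω - w)) ∂μ =
      inner ℝ (∫ ω, toEuclideanLin M (Z ω) ∂μ) (∫ ω, toEuclideanLin N (W ω - w) ∂μ) :=
    hi.integral_bilin ((memLp_toEuclideanLin M hZ).integrable one_le_two) hW'' (innerSL ℝ)
  rw [hprod, integral_toEuclideanLin N hW', integral_sub (hW.integrable one_le_two)
    (integrable_const _)]
  simp [hw]

end L2

/-! ### Strict dissipativity -/

namespace LQProblem

variable {n l m : ℕ} {p : LQProblem n l m}

lemma f_sub_f (x x' : EuclideanSpace ℝ (Fin n)) (u u' : EuclideanSpace ℝ (Fin l))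
    (w w' : EuclideanSpace ℝ (Fin m)) :
    p.f x u w - p.f x' u' w' = toEuclideanLin p.A (x - x') + toEuclideanLin p.B (u - u') +
      toEuclideanLin p.E (w - w') := by
  simp only [f, map_sub]
  abel

lemma inner_sub_inner_eq {k : ℕ} {Q : Matrix (Fin k) (Fin k) ℝ} (hQ : Q.IsHermitian)
    (x x' : EuclideanSpace ℝ (Fin k)) :
    inner ℝ x (toEuclideanLin Q x) - inner ℝ x' (toEuclideanLin Q x') =
      inner ℝ (x - x') (toEuclideanLin Q (x - x')) +
        2 * inner ℝ (x - x') (toEuclideanLin Q x') := by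
  have := inner_toEuclideanLin_comm hQ x x'
  simp only [map_sub, inner_sub_left, inner_sub_right]
  linarith

/-- The data of a linear-quadratic problem from which strict dissipativity is derived: `K` is the
gain of a solution `P` of the Riccati equation, `ν` is a Lagrange multiplier of the optimal steady
state `(xe, ue)`, and `S` certifies detectability. -/
structure Certificate (p : LQProblem n l m) (w : EuclideanSpace ℝ (Fin m))
    (P S : Matrix (Fin n) (Fin n) ℝ) (K : Matrix (Fin l) (Fin n) ℝ)
    (xe : EuclideanSpace ℝ (Fin n)) (ue : EuclideanSpace ℝ (Fin l))
    (ν : EuclideanSpace ℝ (Fin n)) (c : ℝ) : Prop where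
  posDef : S.PosDef
  pos : 0 < c
  steady : p.IsSteadyState w xe ue
  multiplier : ∀ d v, 2 * inner ℝ d (toEuclideanLin p.Q₁ xe) + inner ℝ p.s d +
        (2 * inner ℝ v (toEuclideanLin p.R₁ ue) + inner ℝ p.v v) + inner ℝ ν d
        - inner ℝ ν (toEuclideanLin p.A d + toEuclideanLin p.B v) = 0
  riccati : ∀ d v y, inner ℝ d (toEuclideanLin (p.Q₁ + p.Q₂) y) +
      inner ℝ v (toEuclideanLin (p.R₁ + p.R₂) (toEuclideanLin K y)) -
      inner ℝ d (toEuclideanLin P y) +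
      inner ℝ (toEuclideanLin p.A d + toEuclideanLin p.B v)
        (toEuclideanLin P (toEuclideanLin p.A y + toEuclideanLin p.B (toEuclideanLin K y))) = 0
  detectable : ∀ x u, c * ‖x‖ ^ 2 ≤
        inner ℝ x (toEuclideanLin p.Q₁ x) + inner ℝ u (toEuclideanLin p.R₁ u)
        + inner ℝ x (toEuclideanLin S x)
        - inner ℝ (toEuclideanLin p.A x + toEuclideanLin p.B u)
          (toEuclideanLin S (toEuclideanLin p.A x + toEuclideanLin p.B u))

/-- The integrand of the storage function, with `d` the distance to the stationary state and `y` the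
deviation of the stationary state from its mean. -/
noncomputable def storageDensity (P S : Matrix (Fin n) (Fin n) ℝ)
    (ν d y : EuclideanSpace ℝ (Fin n)) : ℝ :=
  inner ℝ ν d - 2 * inner ℝ d (toEuclideanLin P y) + inner ℝ d (toEuclideanLin S d)

/-- The storage function at the stationary state `Xs` with mean `xe`. -/
noncomputable def storage {Ω : Type*} [MeasurableSpace Ω] (μ : Measure Ω)
    (P S : Matrix (Fin n) (Fin n) ℝ) (ν xe : EuclideanSpace ℝ (Fin n))
    (Xs X : Ω → EuclideanSpace ℝ (Fin n)) : ℝ :=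
  ∫ ω, storageDensity P S ν (X ω - Xs ω) (Xs ω - xe) ∂μ

section

variable {P S : Matrix (Fin n) (Fin n) ℝ} {K : Matrix (Fin l) (Fin n) ℝ}
  {xe : EuclideanSpace ℝ (Fin n)} {ue : EuclideanSpace ℝ (Fin l)}
  {ν : EuclideanSpace ℝ (Fin n)} {c : ℝ} {w : EuclideanSpace ℝ (Fin m)}

/-- The multiplier identity and twice the Riccati identity remove every linear term, leaving the
detectability inequality at `(x - xs, u - us)`. The last storage term is taken at noise-free
successors; `storage_step` justifies this in expectation. -/
lemma Certificate.pointwise (h : p.Certificate w P S K xe ue ν c) (hQ₁ : p.Q₁.IsHermitian)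
    (hR₁ : p.R₁.IsHermitian) (x xs : EuclideanSpace ℝ (Fin n))
    (u us : EuclideanSpace ℝ (Fin l)) (hus : us = toEuclideanLin K (xs - xe) + ue) :
    c * ‖x - xs‖ ^ 2 ≤ p.detStageCost x u - p.detStageCost xs us +
      2 * inner ℝ (x - xs) (toEuclideanLin p.Q₂ (xs - xe)) +
      2 * inner ℝ (u - us) (toEuclideanLin p.R₂ (us - ue)) +
      storageDensity P S ν (x - xs) (xs - xe) -
      storageDensity P S ν (toEuclideanLin p.A (x - xs) + toEuclideanLin p.B (u - us))
        (toEuclideanLin p.A (xs - xe) + toEuclideanLin p.B (toEuclideanLin K (xs - xe))) := by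
  have h1 := h.detectable (x - xs) (u - us)
  have h2 := h.riccati (x - xs) (u - us) (xs - xe)
  have h3 := h.multiplier (x - xs) (u - us)
  have h4 := inner_sub_inner_eq hQ₁ x xs
  have h5 := inner_sub_inner_eq hR₁ u us
  have e1 : us - ue = toEuclideanLin K (xs - xe) := by rw [hus]; abel
  have e2 : inner ℝ (x - xs) (toEuclideanLin p.Q₁ xs) =
      inner ℝ (x - xs) (toEuclideanLin p.Q₁ (xs - xe)) +
        inner ℝ (x - xs) (toEuclideanLin p.Q₁ xe) := by
    rw [← inner_add_right, ← map_add, sub_add_cancel]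
  have e3 : inner ℝ (u - us) (toEuclideanLin p.R₁ us) =
      inner ℝ (u - us) (toEuclideanLin p.R₁ (toEuclideanLin K (xs - xe))) +
        inner ℝ (u - us) (toEuclideanLin p.R₁ ue) := by
    rw [← inner_add_right, ← map_add, ← hus]
  have e4 : inner ℝ p.s (x - xs) = inner ℝ p.s x - inner ℝ p.s xs := inner_sub_right _ _ _
  have e5 : inner ℝ p.v (u - us) = inner ℝ p.v u - inner ℝ p.v us := inner_sub_right _ _ _
  rw [e1]
  simp only [(toEuclideanLin (𝕜 := ℝ)).map_add, LinearMap.add_apply,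
    inner_add_right (x - xs), inner_add_right (u - us)] at h2
  simp only [detStageCost, storageDensity]
  linarith

variable {Ω : Type*} [MeasurableSpace Ω] {μ : Measure Ω}

lemma integrable_storageDensity (P S : Matrix (Fin n) (Fin n) ℝ) (ν : EuclideanSpace ℝ (Fin n))
    [IsProbabilityMeasure μ] {D Y : Ω → EuclideanSpace ℝ (Fin n)} (hD : MemLp D 2 μ)
    (hY : MemLp Y 2 μ) : Integrable (fun ω => storageDensity P S ν (D ω) (Y ω)) μ :=
  ((integrable_inner_of_memLp (memLp_const ν) hD).sub
    ((integrable_inner_toEuclideanLin P hD hY).const_mul 2)).add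
    (integrable_inner_toEuclideanLin S hD hD)

lemma integrable_detStageCost [IsProbabilityMeasure μ] (p : LQProblem n l m)
    {X : Ω → EuclideanSpace ℝ (Fin n)}
    {U : Ω → EuclideanSpace ℝ (Fin l)} (hX : MemLp X 2 μ) (hU : MemLp U 2 μ) :
    Integrable (fun ω => p.detStageCost (X ω) (U ω)) μ :=
  ((((integrable_inner_toEuclideanLin p.Q₁ hX hX).add
    (integrable_inner_toEuclideanLin p.R₁ hU hU)).add
    (integrable_inner_of_memLp (memLp_const p.s) hX)).add
    (integrable_inner_of_memLp (memLp_const p.v) hU)).add (integrable_const _)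

lemma memLp_f [IsProbabilityMeasure μ] (p : LQProblem n l m) {X : Ω → EuclideanSpace ℝ (Fin n)}
    {U : Ω → EuclideanSpace ℝ (Fin l)} {W : Ω → EuclideanSpace ℝ (Fin m)} (hX : MemLp X 2 μ)
    (hU : MemLp U 2 μ) (hW : MemLp W 2 μ) : MemLp (fun ω => p.f (X ω) (U ω) (W ω)) 2 μ :=
  (((memLp_toEuclideanLin p.A hX).add (memLp_toEuclideanLin p.B hU)).add
    (memLp_toEuclideanLin p.E hW)).add (memLp_const _)

/-- The successor of `X - Xs` contains no noise, so noise enters only through the cross term with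
`P`, whose mean is zero. -/
lemma storage_step [IsProbabilityMeasure μ] {Xs Xs' X : Ω → EuclideanSpace ℝ (Fin n)}
    {Us U : Ω → EuclideanSpace ℝ (Fin l)} {W : Ω → EuclideanSpace ℝ (Fin m)}
    (hsteady : p.IsSteadyState (∫ ω, W ω ∂μ) xe ue)
    (hX : MemLp X 2 μ) (hU : MemLp U 2 μ) (hXs : MemLp Xs 2 μ) (hUs : MemLp Us 2 μ)
    (hW : MemLp W 2 μ) (iX : IndepFun X W μ) (iU : IndepFun U W μ) (iXs : IndepFun Xs W μ)
    (iUs : IndepFun Us W μ)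
    (hfb : Us =ᵐ[μ] fun ω => toEuclideanLin K (Xs ω - xe) + ue)
    (hstep : Xs' =ᵐ[μ] fun ω => p.f (Xs ω) (Us ω) (W ω)) :
    storage μ P S ν xe Xs' (fun ω => p.f (X ω) (U ω) (W ω)) =
      ∫ ω, storageDensity P S ν
        (toEuclideanLin p.A (X ω - Xs ω) + toEuclideanLin p.B (U ω - Us ω))
        (toEuclideanLin p.A (Xs ω - xe) +
          toEuclideanLin p.B (toEuclideanLin K (Xs ω - xe))) ∂μ := by
  set w := ∫ ω, W ω ∂μ with hw
  set D : Ω → EuclideanSpace ℝ (Fin n) := fun ω =>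
    toEuclideanLin p.A (X ω - Xs ω) + toEuclideanLin p.B (U ω - Us ω) with hD
  set Y : Ω → EuclideanSpace ℝ (Fin n) := fun ω =>
    toEuclideanLin p.A (Xs ω - xe) + toEuclideanLin p.B (toEuclideanLin K (Xs ω - xe)) with hY
  have hDL : MemLp D 2 μ :=
    (memLp_toEuclideanLin p.A (hX.sub hXs)).add (memLp_toEuclideanLin p.B (hU.sub hUs))
  have hYL : MemLp Y 2 μ := (memLp_toEuclideanLin p.A (hXs.sub (memLp_const xe))).add
    (memLp_toEuclideanLin p.B (memLp_toEuclideanLin K (hXs.sub (memLp_const xe))))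
  have hWL : MemLp (fun ω => W ω - w) 2 μ := hW.sub (memLp_const w)
  have e1 : storage μ P S ν xe Xs' (fun ω => p.f (X ω) (U ω) (W ω)) =
      ∫ ω, (storageDensity P S ν (D ω) (Y ω) -
        2 * inner ℝ (D ω) (toEuclideanLin (P * p.E) (W ω - w))) ∂μ := by
    refine integral_congr_ae ?_
    filter_upwards [hfb, hstep] with ω h1 h2
    have hd : p.f (X ω) (U ω) (W ω) - Xs' ω = D ω := by rw [h2, f_sub_f]; simp [hD]
    have hy : Xs' ω - xe = Y ω + toEuclideanLin p.E (W ω - w) := by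
      have e : Us ω - ue = toEuclideanLin K (Xs ω - xe) := by rw [h1]; abel
      rw [h2]
      nth_rewrite 1 [show xe = p.f xe ue w from hsteady]
      rw [f_sub_f, e]
    rw [hd, hy, storageDensity, storageDensity, map_add, inner_add_right (D ω),
      toEuclideanLin_mul_apply]
    ring
  have z1 := integral_inner_centered_eq_zero p.A (P * p.E) hX hW iX
  have z2 := integral_inner_centered_eq_zero p.A (P * p.E) hXs hW iXs
  have z3 := integral_inner_centered_eq_zero p.B (P * p.E) hU hW iU
  have z4 := integral_inner_centered_eq_zero p.B (P * p.E) hUs hW iUs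
  rw [← hw] at z1 z2 z3 z4
  have i1 := integrable_inner_toEuclideanLin (P * p.E) (memLp_toEuclideanLin p.A hX) hWL
  have i2 := integrable_inner_toEuclideanLin (P * p.E) (memLp_toEuclideanLin p.A hXs) hWL
  have i3 := integrable_inner_toEuclideanLin (P * p.E) (memLp_toEuclideanLin p.B hU) hWL
  have i4 := integrable_inner_toEuclideanLin (P * p.E) (memLp_toEuclideanLin p.B hUs) hWL
  -- `D` is a linear combination of four variables, each independent of `W`; no joint independence
  -- is needed.
  have e2 : ∫ ω, inner ℝ (D ω) (toEuclideanLin (P * p.E) (W ω - w)) ∂μ = 0 := by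
    have : ∀ ω, inner ℝ (D ω) (toEuclideanLin (P * p.E) (W ω - w)) =
        (inner ℝ (toEuclideanLin p.A (X ω)) (toEuclideanLin (P * p.E) (W ω - w)) -
          inner ℝ (toEuclideanLin p.A (Xs ω)) (toEuclideanLin (P * p.E) (W ω - w))) +
        (inner ℝ (toEuclideanLin p.B (U ω)) (toEuclideanLin (P * p.E) (W ω - w)) -
          inner ℝ (toEuclideanLin p.B (Us ω)) (toEuclideanLin (P * p.E) (W ω - w))) := fun ω => by
      rw [← inner_sub_left, ← inner_sub_left, ← inner_add_left, ← map_sub, ← map_sub]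
    simp_rw [this]
    rw [integral_add (f := fun ω => _ - _) (g := fun ω => _ - _) (i1.sub i2) (i3.sub i4),
      integral_sub i1 i2, integral_sub i3 i4, z1, z2, z3, z4]
    simp
  rw [e1, integral_sub (integrable_storageDensity P S ν hDL hYL)
    ((integrable_inner_toEuclideanLin (P * p.E) hDL hWL).const_mul 2), integral_const_mul, e2,
    mul_zero, sub_zero]

/-- The dissipation inequality. -/
lemma Certificate.dissipation [IsProbabilityMeasure μ] {Xs Xs' X : Ω → EuclideanSpace ℝ (Fin n)}
    {Us U : Ω → EuclideanSpace ℝ (Fin l)} {W : Ω → EuclideanSpace ℝ (Fin m)}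
    (h : p.Certificate (∫ ω, W ω ∂μ) P S K xe ue ν c) (hQ₁ : p.Q₁.PosSemidef)
    (hQ₂ : p.Q₂.PosSemidef) (hR₁ : p.R₁.PosDef) (hR₂ : p.R₂.PosSemidef)
    (hX : MemLp X 2 μ) (hU : MemLp U 2 μ) (hXs : MemLp Xs 2 μ) (hUs : MemLp Us 2 μ)
    (hW : MemLp W 2 μ) (iX : IndepFun X W μ) (iU : IndepFun U W μ) (iXs : IndepFun Xs W μ)
    (iUs : IndepFun Us W μ) (hmX : ∫ ω, Xs ω ∂μ = xe) (hmU : ∫ ω, Us ω ∂μ = ue)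
    (hfb : Us =ᵐ[μ] fun ω => toEuclideanLin K (Xs ω - xe) + ue)
    (hstep : Xs' =ᵐ[μ] fun ω => p.f (Xs ω) (Us ω) (W ω)) :
    c * ∫ ω, ‖X ω - Xs ω‖ ^ 2 ∂μ ≤ p.stageCost μ X U - p.stageCost μ Xs Us +
      storage μ P S ν xe Xs X - storage μ P S ν xe Xs' (fun ω => p.f (X ω) (U ω) (W ω)) := by
  rw [storage_step h.steady hX hU hXs hUs hW iX iU iXs iUs hfb hstep]
  have hD := hX.sub hXs
  have hV := hU.sub hUs
  have hY := hXs.sub (memLp_const (μ := μ) xe)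
  have q2 := le_trace_mul_covMatrix_sub hQ₂ hX hXs
  have r2 := le_trace_mul_covMatrix_sub hR₂ hU hUs
  rw [hmX] at q2
  rw [hmU] at r2
  have i1 := integrable_detStageCost p hX hU
  have i2 := integrable_detStageCost p hXs hUs
  have i3 : Integrable (fun ω => 2 * inner ℝ (X ω - Xs ω) (toEuclideanLin p.Q₂ (Xs ω - xe))) μ :=
    (integrable_inner_toEuclideanLin p.Q₂ hD hY).const_mul 2
  have i4 : Integrable (fun ω => 2 * inner ℝ (U ω - Us ω) (toEuclideanLin p.R₂ (Us ω - ue))) μ :=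
    (integrable_inner_toEuclideanLin p.R₂ hV (hUs.sub (memLp_const (μ := μ) ue))).const_mul 2
  have i5 : Integrable (fun ω => storageDensity P S ν (X ω - Xs ω) (Xs ω - xe)) μ :=
    integrable_storageDensity P S ν hD hY
  have i6 : Integrable (fun ω => storageDensity P S ν
        (toEuclideanLin p.A (X ω - Xs ω) + toEuclideanLin p.B (U ω - Us ω))
        (toEuclideanLin p.A (Xs ω - xe) + toEuclideanLin p.B (toEuclideanLin K (Xs ω - xe)))) μ :=
    integrable_storageDensity P S ν
      ((memLp_toEuclideanLin p.A hD).add (memLp_toEuclideanLin p.B hV))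
      ((memLp_toEuclideanLin p.A hY).add
        (memLp_toEuclideanLin p.B (memLp_toEuclideanLin K hY)))
  have iD : Integrable (fun ω => c * ‖X ω - Xs ω‖ ^ 2) μ :=
    (hD.integrable_norm_pow (p := 2) two_ne_zero).const_mul c
  have key := integral_mono_ae iD (((((i1.sub i2).add i3).add i4).add i5).sub i6) (by
      filter_upwards [hfb] with ω hω
      exact h.pointwise hQ₁.1 hR₁.1 (X ω) (Xs ω) (U ω) (Us ω) hω)
  rw [integral_const_mul, integral_sub' ((((i1.sub i2).add i3).add i4).add i5) i6,
    integral_add' (((i1.sub i2).add i3).add i4) i5, integral_add' ((i1.sub i2).add i3) i4,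
    integral_add' (i1.sub i2) i3, integral_sub' i1 i2] at key
  unfold stageCost storage
  linarith

/-- Complete the square in `X - Xs`. The bound does not involve `X` and depends on `Xs` only through
its law. -/
lemma neg_le_storage [IsProbabilityMeasure μ] {s : ℝ} (hs : 0 < s)
    (hS : ∀ x, s * ‖x‖ ^ 2 ≤ inner ℝ x (toEuclideanLin S x))
    {Xs X : Ω → EuclideanSpace ℝ (Fin n)} (hX : MemLp X 2 μ) (hXs : MemLp Xs 2 μ) :
    -∫ ω, (4 * s)⁻¹ * ‖ν - (2 : ℝ) • toEuclideanLin P (Xs ω - xe)‖ ^ 2 ∂μ ≤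
      storage μ P S ν xe Xs X := by
  have hY := hXs.sub (memLp_const (μ := μ) xe)
  have hN : MemLp (fun ω => ν - (2 : ℝ) • toEuclideanLin P (Xs ω - xe)) 2 μ :=
    (memLp_const ν).sub ((memLp_toEuclideanLin P hY).const_smul (2 : ℝ))
  rw [← integral_neg]
  refine integral_mono ((hN.integrable_norm_pow (p := 2) two_ne_zero).const_mul _).neg
    (integrable_storageDensity P S ν (hX.sub hXs) hY) fun ω => ?_
  simp only [storageDensity]
  set d := X ω - Xs ω
  set y := toEuclideanLin P (Xs ω - xe)
  have h1 : inner ℝ ν d - 2 * inner ℝ d y = inner ℝ d (ν - (2 : ℝ) • y) := by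
    rw [inner_sub_right d ν, inner_smul_right, real_inner_comm]
  have h2 := abs_le.1 (abs_real_inner_le_norm d (ν - (2 : ℝ) • y))
  rw [h1]
  have h3 := hS d
  set t := ‖ν - (2 : ℝ) • y‖
  have h4 : 0 ≤ s * ‖d‖ ^ 2 - ‖d‖ * t + (4 * s)⁻¹ * t ^ 2 := by
    have : s * ‖d‖ ^ 2 - ‖d‖ * t + (4 * s)⁻¹ * t ^ 2 = s * (‖d‖ - (2 * s)⁻¹ * t) ^ 2 := by
      field_simp
      ring
    rw [this]
    positivity
  linarith [h2.1]

end

end LQProblem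

/-! ### Stationary laws of stable linear systems with i.i.d. noise -/

section StationaryLaw

variable {n m : ℕ} {Ω : Type*} [MeasurableSpace Ω] {μ : Measure Ω}

lemma measurable_toEuclideanLin (M : Matrix (Fin n) (Fin m) ℝ) :
    Measurable (fun x => toEuclideanLin M x) :=
  (LinearMap.continuous_of_finiteDimensional _).measurable

lemma charFun_map_toEuclideanLin (M : Matrix (Fin n) (Fin m) ℝ)
    (ρ : Measure (EuclideanSpace ℝ (Fin m))) (t : EuclideanSpace ℝ (Fin n)) :
    charFun (ρ.map fun x => toEuclideanLin M x) t = charFun ρ (toEuclideanLin Mᵀ t) := by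
  rw [charFun_apply, charFun_apply, integral_map (measurable_toEuclideanLin M).aemeasurable
    (by fun_prop)]
  simp_rw [inner_toEuclideanLin_transpose]

lemma map_toEuclideanLin_comp (M : Matrix (Fin n) (Fin m) ℝ) {Z : Ω → EuclideanSpace ℝ (Fin m)}
    (hZ : AEMeasurable Z μ) :
    μ.map (fun ω => toEuclideanLin M (Z ω)) = (μ.map Z).map fun x => toEuclideanLin M x := by
  rw [AEMeasurable.map_map_of_aemeasurable (measurable_toEuclideanLin M).aemeasurable hZ]
  rfl

/-- A series of random vectors whose norms in `L²` are dominated by a convergent geometric series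
converges almost surely to a square-integrable random vector. -/
lemma exists_ae_hasSum_of_geometric {V : ℕ → Ω → EuclideanSpace ℝ (Fin n)}
    (hV : ∀ j, MemLp (V j) 2 μ) {b : ENNReal} (hb : b ≠ ⊤) {C r : ℝ} (hC : 0 ≤ C) (hr : 0 ≤ r)
    (hr1 : r < 1) (hle : ∀ j, eLpNorm (V j) 2 μ ≤ ENNReal.ofReal (C * r ^ j) * b) :
    ∃ Y : Ω → EuclideanSpace ℝ (Fin n), MemLp Y 2 μ ∧
      ∀ᵐ ω ∂μ, HasSum (fun j => V j ω) (Y ω) := by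
  have hsum : ∑' j, ‖(hV j).toLp (V j)‖ₑ ≠ ⊤ := by
    have h1 : ∀ j, ‖(hV j).toLp (V j)‖ₑ ≤ ENNReal.ofReal (C * r ^ j) * b := fun j => by
      rw [Lp.enorm_toLp]
      exact hle j
    have hs : Summable fun j => C * r ^ j := (summable_geometric_of_lt_one hr hr1).mul_left C
    refine ne_top_of_le_ne_top ?_ (ENNReal.tsum_le_tsum h1)
    rw [ENNReal.tsum_mul_right, ← ENNReal.ofReal_tsum_of_nonneg (fun j => by positivity) hs]
    exact ENNReal.mul_ne_top ENNReal.ofReal_ne_top hb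
  refine ⟨_, Lp.memLp (∑' j, (hV j).toLp (V j)), ?_⟩
  filter_upwards [Lp.hasSum_coeFn_tsum hsum, ae_all_iff.2 fun j => (hV j).coeFn_toLp] with ω h1 h2
  simpa only [h2] using h1

variable [IsProbabilityMeasure μ]

/-- Dominated convergence applies because the integrands have modulus one. -/
lemma tendsto_charFun_map {S : ℕ → Ω → EuclideanSpace ℝ (Fin n)} {Y : Ω → EuclideanSpace ℝ (Fin n)}
    (hS : ∀ k, AEMeasurable (S k) μ) (hY : AEMeasurable Y μ)
    (h : ∀ᵐ ω ∂μ, Filter.Tendsto (fun k => S k ω) Filter.atTop (nhds (Y ω)))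
    (t : EuclideanSpace ℝ (Fin n)) :
    Filter.Tendsto (fun k => charFun (μ.map (S k)) t) Filter.atTop
      (nhds (charFun (μ.map Y) t)) := by
  have e : ∀ {Z : Ω → EuclideanSpace ℝ (Fin n)}, AEMeasurable Z μ → charFun (μ.map Z) t =
      ∫ ω, Complex.exp (inner ℝ (Z ω) t * Complex.I) ∂μ := fun hZ => by
    rw [charFun_apply, integral_map hZ (by fun_prop)]
  rw [e hY]
  simp_rw [fun k => e (hS k)]
  have hc : Continuous fun x : EuclideanSpace ℝ (Fin n) =>
      Complex.exp (inner ℝ x t * Complex.I) := by fun_prop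
  refine tendsto_integral_of_dominated_convergence (fun _ => 1)
    (fun k => (hc.measurable.comp_aemeasurable (hS k)).aestronglyMeasurable)
    (integrable_const _) (fun k => ae_of_all _ fun ω => ?_) ?_
  · rw [Complex.norm_exp_ofReal_mul_I]
  · filter_upwards [h] with ω hω
    exact (hc.tendsto _).comp hω

/-- An exponentially stable linear system driven by centered i.i.d. noise has a centered
square-integrable stationary law. -/
lemma exists_stationary_law {M : Matrix (Fin n) (Fin n) ℝ} (E : Matrix (Fin n) (Fin m) ℝ)
    {C r : ℝ} (hC : 0 ≤ C) (hr : 0 ≤ r) (hr1 : r < 1)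
    (hM : ∀ (k : ℕ) x, ‖toEuclideanLin (M ^ k) x‖ ≤ C * r ^ k * ‖x‖)
    {W : ℕ → Ω → EuclideanSpace ℝ (Fin m)} (hWindep : iIndepFun W μ)
    (hWident : ∀ k, IdentDistrib (W k) (W 0) μ μ) (hWL2 : ∀ k, MemLp (W k) 2 μ) :
    ∃ ρ : Measure (EuclideanSpace ℝ (Fin n)), IsProbabilityMeasure ρ ∧ MemLp id 2 ρ ∧
      ∫ y, y ∂ρ = 0 ∧ ∀ t, charFun ρ t = charFun ρ (toEuclideanLin Mᵀ t) *
        charFun (μ.map fun ω => toEuclideanLin E (W 0 ω - ∫ ω', W 0 ω' ∂μ)) t := by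
  set w := ∫ ω', W 0 ω' ∂μ with hw
  set Z : ℕ → Ω → EuclideanSpace ℝ (Fin n) := fun j ω => toEuclideanLin E (W j ω - w) with hZ
  have hφ : Measurable fun x => toEuclideanLin E (x - w) :=
    (measurable_toEuclideanLin E).comp (measurable_id.sub_const w)
  have hZident : ∀ j, IdentDistrib (Z j) (Z 0) μ μ := fun j => (hWident j).comp hφ
  have hZL2 : ∀ j, MemLp (Z j) 2 μ := fun j =>
    memLp_toEuclideanLin E ((hWL2 j).sub (memLp_const w))
  have hZmean : ∀ j, ∫ ω, Z j ω ∂μ = 0 := fun j => by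
    rw [(hZident j).integral_eq]
    simp only [hZ]
    have h0 : Integrable (fun ω => W 0 ω - w) μ :=
      ((hWL2 0).sub (memLp_const w)).integrable one_le_two
    rw [integral_toEuclideanLin E h0,
      integral_sub ((hWL2 0).integrable one_le_two) (integrable_const _)]
    simp [hw]
  -- The summands of the recursion unrolled into the infinite past. Only the law of the sum matters,
  -- so i.i.d. noise may be indexed forwards.
  set V : ℕ → Ω → EuclideanSpace ℝ (Fin n) := fun j ω => toEuclideanLin (M ^ j) (Z j ω) with hV
  have hVL2 : ∀ j, MemLp (V j) 2 μ := fun j => memLp_toEuclideanLin (M ^ j) (hZL2 j)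
  have hVindep : iIndepFun V μ :=
    hWindep.comp (fun j x => toEuclideanLin (M ^ j) (toEuclideanLin E (x - w)))
      fun j => (measurable_toEuclideanLin (M ^ j)).comp hφ
  obtain ⟨Y, hY, hsum⟩ := exists_ae_hasSum_of_geometric hVL2 (hZL2 0).eLpNorm_ne_top hC hr hr1
    fun j => by
      rw [← (hZident j).eLpNorm_eq]
      exact eLpNorm_le_mul_eLpNorm_of_ae_le_mul (ae_of_all _ fun ω => hM j (Z j ω)) 2
  have hmean : ∫ ω, Y ω ∂μ = 0 := by
    have hs : Summable fun j => ∫ ω, ‖V j ω‖ ∂μ := by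
      refine Summable.of_nonneg_of_le (fun j => by positivity) (fun j => ?_)
        (((summable_geometric_of_lt_one hr hr1).mul_left C).mul_right (∫ ω, ‖Z 0 ω‖ ∂μ))
      rw [← (hZident j).norm.integral_eq, ← integral_const_mul]
      exact integral_mono ((hVL2 j).integrable one_le_two).norm
        (((hZL2 j).integrable one_le_two).norm.const_mul _) fun ω => hM j (Z j ω)
    have h1 := hasSum_integral_of_summable_integral_norm
      (fun j => (hVL2 j).integrable one_le_two) hs
    have h2 : ∀ j, ∫ ω, V j ω ∂μ = 0 := fun j => by
      simp only [hV]
      rw [integral_toEuclideanLin _ ((hZL2 j).integrable one_le_two), hZmean, map_zero]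
    simp_rw [h2] at h1
    rw [integral_congr_ae (g := fun ω => ∑' j, V j ω) (by
      filter_upwards [hsum] with ω hω using hω.tsum_eq.symm)]
    exact h1.unique hasSum_zero
  have hVae : ∀ j, AEMeasurable (V j) μ := fun j => (hVL2 j).aestronglyMeasurable.aemeasurable
  have hVchar : ∀ j t, charFun (μ.map (V j)) t =
      charFun (μ.map (Z 0)) (toEuclideanLin (M ^ j)ᵀ t) := fun j t => by
    simp only [hV]
    rw [map_toEuclideanLin_comp _ (hZL2 j).aestronglyMeasurable.aemeasurable,
      charFun_map_toEuclideanLin, (hZident j).map_eq]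
  have hYae : AEMeasurable Y μ := hY.aestronglyMeasurable.aemeasurable
  have hlim : ∀ t, Filter.Tendsto (fun k => ∏ j ∈ Finset.range k,
      charFun (μ.map (Z 0)) (toEuclideanLin (M ^ j)ᵀ t)) Filter.atTop
      (nhds (charFun (μ.map Y) t)) := fun t => by
    have h := tendsto_charFun_map (S := fun k ω => ∑ j ∈ Finset.range k, V j ω)
      (fun k => Finset.aemeasurable_fun_sum _ fun j _ => hVae j) hYae
      (by filter_upwards [hsum] with ω hω using hω.tendsto_sum_nat) t
    refine h.congr fun k => ?_
    have hres : iIndepFun ((Finset.range k).restrict V) μ :=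
      hVindep.precomp (g := fun i : Finset.range k => (i : ℕ)) Subtype.val_injective
    rw [iIndepFun.charFun_map_fun_finsetSum_eq_prod (fun j _ => hVae j) hres, Finset.prod_apply]
    exact Finset.prod_congr rfl fun j _ => hVchar j t
  have hprob : IsProbabilityMeasure (μ.map Y) := Measure.isProbabilityMeasure_map hYae
  refine ⟨μ.map Y, hprob, ?_, ?_, fun t => ?_⟩
  · exact (memLp_map_measure_iff aestronglyMeasurable_id hYae).2 hY
  · exact (integral_map hYae aestronglyMeasurable_id).trans hmean
  · refine tendsto_nhds_unique ((Filter.tendsto_add_atTop_iff_nat 1).2 (hlim t)) ?_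
    refine ((hlim (toEuclideanLin Mᵀ t)).mul_const _).congr fun k => ?_
    -- The factor `j = 0` is that of the noise; `(M ^ (j + 1))ᵀ = (M ^ j)ᵀ * Mᵀ` turns the others
    -- into the product at `Mᵀ t`.
    rw [Finset.prod_range_succ']
    simp only [pow_zero, transpose_one, toEuclideanLin_one_apply, pow_succ', transpose_mul,
      toEuclideanLin_mul_apply]
    rfl

/-- A law whose characteristic function satisfies the fixed point equation of the linear system is
invariant under the dynamics. -/
lemma hasLaw_of_charFun_invariant {M : Matrix (Fin n) (Fin n) ℝ}
    {ρ : Measure (EuclideanSpace ℝ (Fin n))} [IsProbabilityMeasure ρ]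
    {σ : Measure (EuclideanSpace ℝ (Fin n))}
    (hρ : ∀ t, charFun ρ t = charFun ρ (toEuclideanLin Mᵀ t) * charFun σ t)
    {Y V : Ω → EuclideanSpace ℝ (Fin n)} (hY : HasLaw Y ρ μ) (hV : HasLaw V σ μ)
    (h : IndepFun Y V μ) : HasLaw (fun ω => toEuclideanLin M (Y ω) + V ω) ρ μ := by
  have hMY : AEMeasurable (fun ω => toEuclideanLin M (Y ω)) μ :=
    (measurable_toEuclideanLin M).comp_aemeasurable hY.aemeasurable
  have hm : AEMeasurable (fun ω => toEuclideanLin M (Y ω) + V ω) μ := hMY.add hV.aemeasurable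
  have hprob := Measure.isProbabilityMeasure_map (μ := μ) hm
  refine ⟨hm, Measure.ext_of_charFun ?_⟩
  have hi : IndepFun (fun ω => toEuclideanLin M (Y ω)) V μ :=
    h.comp (measurable_toEuclideanLin M) measurable_id
  rw [hi.charFun_map_fun_add_eq_mul hMY hV.aemeasurable]
  ext t
  rw [Pi.mul_apply, map_toEuclideanLin_comp M hY.aemeasurable, charFun_map_toEuclideanLin,
    hY.map_eq, hV.map_eq, ← hρ]

end StationaryLaw

/-! ### Existence of the stationary process -/

section Existence

variable {Ω : Type*} [MeasurableSpace Ω] {μ : Measure Ω}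

/-- The joint law is a triple product measure, which can be reassociated. -/
lemma indepFun_prodMk_left [IsProbabilityMeasure μ] {α β γ : Type*}
    [MeasurableSpace α] [MeasurableSpace β] [MeasurableSpace γ] {X : Ω → α} {Y : Ω → β} {Z : Ω → γ} (hX : AEMeasurable X μ)
    (hY : AEMeasurable Y μ) (hZ : AEMeasurable Z μ)
    (h : IndepFun X (fun ω => (Y ω, Z ω)) μ) (h' : IndepFun Y Z μ) :
    IndepFun (fun ω => (X ω, Y ω)) Z μ := by
  have hXY : IndepFun X Y μ := h.comp (φ := id) measurable_id measurable_fst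
  have pX := Measure.isProbabilityMeasure_map hX
  have pY := Measure.isProbabilityMeasure_map hY
  have pZ := Measure.isProbabilityMeasure_map hZ
  rw [indepFun_iff_map_prod_eq_prod_map_map (hX.prodMk hY) hZ,
    (indepFun_iff_map_prod_eq_prod_map_map hX hY).1 hXY]
  have h1 := (indepFun_iff_map_prod_eq_prod_map_map hX (hY.prodMk hZ)).1 h
  rw [(indepFun_iff_map_prod_eq_prod_map_map hY hZ).1 h'] at h1
  have h2 := congrArg (fun ν => ν.map MeasurableEquiv.prodAssoc.symm) h1
  rw [AEMeasurable.map_map_of_aemeasurable (by fun_prop) (hX.prodMk (hY.prodMk hZ)),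
    ← Measure.prodAssoc_prod, Measure.map_map (by fun_prop) (by fun_prop)] at h2
  simp only [MeasurableEquiv.symm_comp_self, Measure.map_id] at h2
  exact h2

lemma indepFun_tail {β : Type*} [MeasurableSpace β] {W : ℕ → Ω → β} (hW : ∀ k, Measurable (W k))
    (h : iIndepFun W μ) (k : ℕ) : IndepFun (W k) (fun ω j => W (k + 1 + j) ω) μ := by
  have hind := indep_iSup_of_disjoint (fun i => (hW i).comap_le) h
    (S := {k}) (T := {i | k < i}) (by simp)
  rw [IndepFun_iff_Indep]
  refine indep_of_indep_of_le_right (indep_of_indep_of_le_left hind ?_) ?_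
  · simp
  · rw [MeasurableSpace.pi, MeasurableSpace.comap_iSup]
    refine iSup_le fun j => ?_
    rw [MeasurableSpace.comap_comp]
    exact le_iSup₂_of_le (k + 1 + j) (by simp; omega) le_rfl

/-- A random recursion whose initial value is independent of the noise is at each time independent
of the present and future noise. -/
lemma indepFun_of_recursion [IsProbabilityMeasure μ] {α β : Type*}
    [MeasurableSpace α] [MeasurableSpace β]
    {W : ℕ → Ω → β} (hW : ∀ k, Measurable (W k)) (h : iIndepFun W μ) {g : α → β → α}
    (hg : Measurable (Function.uncurry g)) {X : ℕ → Ω → α} (hX : AEMeasurable (X 0) μ)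
    (h0 : IndepFun (X 0) (fun ω k => W k ω) μ) (hstep : ∀ k ω, X (k + 1) ω = g (X k ω) (W k ω))
    (k : ℕ) : AEMeasurable (X k) μ ∧ IndepFun (X k) (fun ω j => W (k + j) ω) μ := by
  induction k with
  | zero => exact ⟨hX, by simpa using h0⟩
  | succ k ih =>
    obtain ⟨hm, hi⟩ := ih
    have hsucc : X (k + 1) = Function.uncurry g ∘ fun ω => (X k ω, W k ω) := funext fun ω =>
      hstep k ω
    have hT : Measurable fun ω j => W (k + 1 + j) ω := measurable_pi_lambda _ fun j => hW _
    refine ⟨hsucc ▸ hg.comp_aemeasurable (hm.prodMk (hW k).aemeasurable), ?_⟩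
    -- The next state uses up `W k`, so the induction must carry independence of the whole future
    -- and split off its first term.
    have h1 : IndepFun (X k) (fun ω => (W k ω, fun j => W (k + 1 + j) ω)) μ := by
      have := hi.comp (φ := id) (ψ := fun s : ℕ → β => (s 0, fun j => s (1 + j))) measurable_id
        (by fun_prop)
      simpa [Function.comp_def, add_assoc] using this
    have h2 := indepFun_prodMk_left hm (hW k).aemeasurable hT.aemeasurable h1
      (indepFun_tail hW h k)
    rw [hsucc]
    exact h2.comp hg measurable_id

/-- Every law on a standard Borel space is an image of Lebesgue measure on the unit interval;
`projIcc` only extends that map to the real line. -/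
lemma exists_hasLaw_of_uniform {β : Type*} [MeasurableSpace β] [StandardBorelSpace β] [Nonempty β]
    (ρ : Measure β) [IsProbabilityMeasure ρ] {ξ : Ω → ℝ}
    (hξ : HasLaw ξ (volume.restrict (Set.Icc 0 1)) μ) :
    ∃ g : ℝ → β, Measurable g ∧ HasLaw (fun ω => g (ξ ω)) ρ μ := by
  obtain ⟨g, hg, hmap⟩ := ρ.exists_measurable_map_eq
  have hp : Measurable (Set.projIcc (0 : ℝ) 1 zero_le_one) := continuous_projIcc.measurable
  have hgp : Measurable fun x => g (Set.projIcc (0 : ℝ) 1 zero_le_one x) := hg.comp hp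
  refine ⟨_, hgp, hgp.comp_aemeasurable hξ.aemeasurable, ?_⟩
  have h1 : (volume : Measure (Set.Icc (0 : ℝ) 1)).map Subtype.val =
      volume.restrict (Set.Icc 0 1) := (measurePreserving_subtype_coe measurableSet_Icc).map_eq
  have h2 : μ.map (fun ω => g (Set.projIcc (0 : ℝ) 1 zero_le_one (ξ ω))) =
      (μ.map ξ).map fun x => g (Set.projIcc (0 : ℝ) 1 zero_le_one x) := by
    rw [AEMeasurable.map_map_of_aemeasurable hgp.aemeasurable hξ.aemeasurable]
    rfl
  rw [h2, hξ.map_eq, ← h1, Measure.map_map hgp measurable_subtype_coe, ← hmap]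
  congr 1
  ext x
  simp

end Existence

namespace LQProblem

variable {n l m : ℕ} {p : LQProblem n l m} {K : Matrix (Fin l) (Fin n) ℝ}
  {xe : EuclideanSpace ℝ (Fin n)} {ue : EuclideanSpace ℝ (Fin l)}
  {Ω : Type*} [MeasurableSpace Ω] {μ : Measure Ω}
  {W : ℕ → Ω → EuclideanSpace ℝ (Fin m)}

lemma exists_isFeedbackSolution [IsProbabilityMeasure μ] (hW : ∀ k, Measurable (W k))
    (hWindep : iIndepFun W μ) (ϱ : Measure (EuclideanSpace ℝ (Fin n))) [IsProbabilityMeasure ϱ] {ξ : Ω → ℝ}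
    (hξ : HasLaw ξ (volume.restrict (Set.Icc 0 1)) μ)
    (hξW : IndepFun ξ (fun ω k => W k ω) μ) :
    ∃ Xs Us, p.IsFeedbackSolution μ W K xe ue ϱ Xs Us := by
  obtain ⟨g, hg, hlaw⟩ := exists_hasLaw_of_uniform ϱ hξ
  let F : EuclideanSpace ℝ (Fin n) → EuclideanSpace ℝ (Fin m) → EuclideanSpace ℝ (Fin n) :=
    fun x w => p.f x (toEuclideanLin K (x - xe) + ue) w
  have hF : Measurable (Function.uncurry F) := by
    have hA := measurable_toEuclideanLin p.A
    have hB := measurable_toEuclideanLin p.B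
    have hE := measurable_toEuclideanLin p.E
    have hK := measurable_toEuclideanLin K
    exact (((hA.comp measurable_fst).add (hB.comp ((hK.comp
      (measurable_fst.sub_const xe)).add_const ue))).add (hE.comp measurable_snd)).add_const p.z
  let X : ℕ → Ω → EuclideanSpace ℝ (Fin n) := fun k =>
    Nat.rec (fun ω => g (ξ ω)) (fun k x ω => F (x ω) (W k ω)) k
  have h := indepFun_of_recursion hW hWindep hF (X := X) hlaw.aemeasurable
    (hξW.comp hg measurable_id) (fun k ω => rfl)
  refine ⟨X, fun k ω => toEuclideanLin K (X k ω - xe) + ue, hlaw, fun k => ?_,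
    fun k => Filter.EventuallyEq.rfl, fun k => Filter.EventuallyEq.rfl⟩
  exact (h k).2.comp measurable_id (measurable_pi_apply 0)

/-- Centring at the steady state turns the affine closed loop into a linear system with noise `v -
w`. -/
lemma closedLoop_eq {w v : EuclideanSpace ℝ (Fin m)} (hsteady : p.IsSteadyState w xe ue)
    (x : EuclideanSpace ℝ (Fin n)) :
    p.f x (toEuclideanLin K (x - xe) + ue) v =
      toEuclideanLin (p.A + p.B * K) (x - xe) + toEuclideanLin p.E (v - w) + xe := by
  have h := f_sub_f (p := p) x xe (toEuclideanLin K (x - xe) + ue) ue v w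
  rw [← show xe = p.f xe ue w from hsteady, sub_eq_iff_eq_add] at h
  rw [h, map_add, LinearMap.add_apply, toEuclideanLin_mul_apply, add_sub_cancel_right]

lemma hasLaw_sub_const_iff {ρ : Measure (EuclideanSpace ℝ (Fin n))}
    {X : Ω → EuclideanSpace ℝ (Fin n)} :
    HasLaw X (ρ.map (· + xe)) μ ↔ HasLaw (fun ω => X ω - xe) ρ μ := by
  have ha : Measurable fun y : EuclideanSpace ℝ (Fin n) => y + xe := measurable_id.add_const xe
  have hs : Measurable fun y : EuclideanSpace ℝ (Fin n) => y - xe := measurable_id.sub_const xe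
  constructor <;> intro h
  · refine HasLaw.fun_comp (X := X) (Y := fun y => y - xe) ⟨hs.aemeasurable, ?_⟩ h
    rw [Measure.map_map hs ha]
    simp [Function.comp_def]
  · have := HasLaw.fun_comp (X := fun ω => X ω - xe) (Y := fun y => y + xe)
      ⟨ha.aemeasurable, rfl⟩ h
    simpa using this

/-- The state of a feedback solution started in the stationary law stays in that law. -/
lemma IsFeedbackSolution.hasLaw [IsProbabilityMeasure μ]
    {ρ : Measure (EuclideanSpace ℝ (Fin n))} [IsProbabilityMeasure ρ]
    {w : EuclideanSpace ℝ (Fin m)} (hsteady : p.IsSteadyState w xe ue)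
    (hWident : ∀ k, IdentDistrib (W k) (W 0) μ μ)
    (hρ : ∀ t, charFun ρ t = charFun ρ (toEuclideanLin (p.A + p.B * K)ᵀ t) *
        charFun (μ.map fun ω => toEuclideanLin p.E (W 0 ω - w)) t)
    {Xs : ℕ → Ω → EuclideanSpace ℝ (Fin n)} {Us : ℕ → Ω → EuclideanSpace ℝ (Fin l)}
    (h : p.IsFeedbackSolution μ W K xe ue (ρ.map (· + xe)) Xs Us) (k : ℕ) :
    HasLaw (Xs k) (ρ.map (· + xe)) μ := by
  induction k with
  | zero => exact h.law_zero
  | succ k ih =>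
    have hφ : Measurable fun x => toEuclideanLin p.E (x - w) :=
      (measurable_toEuclideanLin p.E).comp (measurable_id.sub_const w)
    have hid : IdentDistrib (fun ω => toEuclideanLin p.E (W k ω - w))
      (fun ω => toEuclideanLin p.E (W 0 ω - w)) μ μ := (hWident k).comp hφ
    have hi : IndepFun (fun ω => Xs k ω - xe) (fun ω => toEuclideanLin p.E (W k ω - w)) μ :=
      (h.indep k).comp (measurable_id.sub_const xe) hφ
    have hlaw := hasLaw_of_charFun_invariant hρ (hasLaw_sub_const_iff.1 ih)
      ⟨hid.aemeasurable_fst, hid.map_eq⟩ hi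
    rw [hasLaw_sub_const_iff]
    refine hlaw.congr ?_
    filter_upwards [h.step k, h.feedback k] with ω h1 h2
    rw [h1, h2, closedLoop_eq hsteady, add_sub_cancel_right]

lemma _root_.StochLQ.isP2_of_memLp [IsProbabilityMeasure μ] {d : ℕ}
    {ϱ : Measure (EuclideanSpace ℝ (Fin d))}
    {X : Ω → EuclideanSpace ℝ (Fin d)} (hX : MemLp X 2 μ) (h : HasLaw X ϱ μ) : IsP2 ϱ := by
  refine ⟨h.isProbabilityMeasure_iff.1 inferInstance, ?_⟩
  rw [← h.lintegral_comp (f := fun x => ‖x‖ₑ ^ 2) (by fun_prop)]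
  have := (eLpNorm_lt_top_iff_lintegral_rpow_enorm_lt_top two_ne_zero ENNReal.ofNat_ne_top).1
    hX.eLpNorm_lt_top
  simpa using this

end LQProblem

/-! ### The turnpike property -/

lemma isKInfty_const_mul {c : ℝ} (hc : 0 < c) : IsKInfty fun r => c * r where
  continuousOn := (continuous_const_mul c).continuousOn
  strictMonoOn := fun _ _ _ _ h => mul_lt_mul_of_pos_left h hc
  map_zero := mul_zero c
  unbounded := fun M => ⟨(|M| + 1) / c, by positivity, by
    rw [mul_div_cancel₀ _ hc.ne']
    linarith [le_abs_self M]⟩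

namespace LQProblem

variable {n l m : ℕ} {p : LQProblem n l m} {Ω : Type*} [MeasurableSpace Ω] {μ : Measure Ω}

lemma mul_lt_integral_norm_sq {D : Ω → EuclideanSpace ℝ (Fin n)} (hD : MemLp D 2 μ) {ε η : ℝ}
    (hε : 0 < ε) (h : η < μ.real {ω | ε ≤ ‖D ω‖}) : ε ^ 2 * η < ∫ ω, ‖D ω‖ ^ 2 ∂μ := by
  have h1 := mul_meas_ge_le_integral_of_nonneg (ae_of_all μ fun ω => sq_nonneg ‖D ω‖)
    (hD.integrable_norm_pow (p := 2) two_ne_zero) (ε ^ 2)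
  have e : {ω | ε ^ 2 ≤ ‖D ω‖ ^ 2} = {ω | ε ≤ ‖D ω‖} := by
    ext ω
    exact sq_le_sq₀ hε.le (norm_nonneg _)
  rw [e] at h1
  exact (mul_lt_mul_of_pos_left h (by positivity)).trans_le h1

/-- Bounded accumulated `L²`-distance implies the turnpike property in probability. -/
lemma sub_div_le_turnpikeCount {X Xs : ℕ → Ω → EuclideanSpace ℝ (Fin n)} {N : ℕ} {c b : ℝ}
    (hc : 0 < c) (hD : ∀ k < N, MemLp (fun ω => X k ω - Xs k ω) 2 μ)
    (hsum : ∑ k ∈ Finset.range N, c * ∫ ω, ‖X k ω - Xs k ω‖ ^ 2 ∂μ ≤ b) {ε η : ℝ}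
    (hε : 0 < ε) (hη : 0 < η) :
    (N : ℝ) - b / (c * (ε ^ 2 * η)) ≤ (turnpikeCount μ X Xs N ε η : ℝ) := by
  classical
  have hpos : 0 < c * (ε ^ 2 * η) := by positivity
  set good := (Finset.range N).filter fun k => μ.real {ω | ε ≤ ‖X k ω - Xs k ω‖} ≤ η with hgood
  set bad := (Finset.range N).filter fun k => ¬ μ.real {ω | ε ≤ ‖X k ω - Xs k ω‖} ≤ η with hbad
  have hcount : turnpikeCount μ X Xs N ε η = good.card := by
    rw [turnpikeCount, hgood]
  have hcard : (good.card : ℝ) + bad.card = N := by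
    have := Finset.card_filter_add_card_filter_not (s := Finset.range N)
      fun k => μ.real {ω | ε ≤ ‖X k ω - Xs k ω‖} ≤ η
    rw [Finset.card_range] at this
    exact_mod_cast this
  -- By Markov's inequality each bad time contributes at least `c ε² η` to the sum, and the other
  -- times contribute nonnegatively.
  have hle : bad.card * (c * (ε ^ 2 * η)) ≤ b := by
    refine le_trans ?_ hsum
    calc bad.card * (c * (ε ^ 2 * η)) = ∑ k ∈ bad, c * (ε ^ 2 * η) := by simp
      _ ≤ ∑ k ∈ bad, c * ∫ ω, ‖X k ω - Xs k ω‖ ^ 2 ∂μ := by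
        refine Finset.sum_le_sum fun k hk => ?_
        rw [hbad, Finset.mem_filter, Finset.mem_range, not_le] at hk
        have := mul_lt_integral_norm_sq (hD k hk.1) hε hk.2
        gcongr
      _ ≤ _ := Finset.sum_le_sum_of_subset_of_nonneg (Finset.filter_subset _ _)
        fun k _ _ => by positivity
  rw [hcount]
  have : (bad.card : ℝ) ≤ b / (c * (ε ^ 2 * η)) := by rwa [le_div_iff₀ hpos]
  linarith

variable [IsProbabilityMeasure μ]

lemma memLp_traj {W : ℕ → Ω → EuclideanSpace ℝ (Fin m)} (hW : ∀ k, MemLp (W k) 2 μ)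
    {X₀ : Ω → EuclideanSpace ℝ (Fin n)} (hX₀ : MemLp X₀ 2 μ)
    {U : ℕ → Ω → EuclideanSpace ℝ (Fin l)} {N : ℕ} (hU : ∀ k < N, MemLp (U k) 2 μ) :
    ∀ k ≤ N, MemLp (p.traj W X₀ U k) 2 μ := by
  intro k
  induction k with
  | zero => exact fun _ => hX₀
  | succ k ih => exact fun hk => memLp_f p (ih (by omega)) (hU k (by omega)) (hW k)

/-- The turnpike property in probability follows from strict dissipativity with a linear comparison
function. -/
lemma IsStrictlyDissipativeWith.exists_turnpike {c : ℝ} (hc : 0 < c)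
    {W : ℕ → Ω → EuclideanSpace ℝ (Fin m)} (hW : ∀ k, MemLp (W k) 2 μ)
    {Xs : ℕ → Ω → EuclideanSpace ℝ (Fin n)} {Us : ℕ → Ω → EuclideanSpace ℝ (Fin l)}
    (hXs : ∀ k, MemLp (Xs k) 2 μ)
    (h : p.IsStrictlyDissipativeWith μ W Xs Us fun r => c * r)
    {X₀ : Ω → EuclideanSpace ℝ (Fin n)} (hX₀ : MemLp X₀ 2 μ) :
    ∃ C : ℝ, ∀ (N : ℕ) (δ : ℝ), 0 < δ →
      ∀ U : ℕ → Ω → EuclideanSpace ℝ (Fin l), p.IsAdmissible μ W N X₀ U →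
        p.cost μ W N X₀ U ≤ δ + ∑ k ∈ Finset.range N, p.stageCost μ (Xs k) (Us k) →
        ∀ ε η : ℝ, 0 < ε → 0 < η →
          (N : ℝ) - (δ + C) / (c * (ε ^ 2 * η)) ≤
            (turnpikeCount μ (p.traj W X₀ U) Xs N ε η : ℝ) := by
  obtain ⟨-, stor, -, ⟨b, hb⟩, hdiss⟩ := h
  -- Initial storage minus its lower bound: what the telescoped inequality leaves over, independent
  -- of the horizon and the control.
  refine ⟨stor 0 X₀ - b, fun N δ _ U hU hcost ε η hε hη => ?_⟩
  have hX := memLp_traj (p := p) hW hX₀ hU.memLp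
  refine sub_div_le_turnpikeCount hc (fun k hk => (hX k hk.le).sub (hXs k)) ?_ hε hη
  have hsum : ∀ k ≤ N, ∑ j ∈ Finset.range k, c * ∫ ω, ‖p.traj W X₀ U j ω - Xs j ω‖ ^ 2 ∂μ ≤
      ∑ j ∈ Finset.range k, p.stageCost μ (p.traj W X₀ U j) (U j) -
        ∑ j ∈ Finset.range k, p.stageCost μ (Xs j) (Us j) +
        stor 0 X₀ - stor k (p.traj W X₀ U k) := by
    intro k
    induction k with
    | zero => intro _; simp [traj]
    | succ k ih =>
      intro hk
      have h1 := ih (by omega)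
      have h2 := hdiss k (p.traj W X₀ U k) (U k) (hX k (by omega)) (hU.memLp k (by omega))
        (hU.indep_state k (by omega)) (hU.indep_control k (by omega))
      simp only [Finset.sum_range_succ]
      have e : p.traj W X₀ U (k + 1) = fun ω => p.f (p.traj W X₀ U k ω) (U k ω) (W k ω) := rfl
      rw [e]
      linarith
  have h1 := hsum N le_rfl
  have h2 := hb N _ (hX N le_rfl)
  rw [cost] at hcost
  linarith

/-- Strict dissipativity at a feedback solution with constant centered law. -/
lemma Certificate.isStrictlyDissipativeWith {P S : Matrix (Fin n) (Fin n) ℝ}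
    {K : Matrix (Fin l) (Fin n) ℝ} {xe : EuclideanSpace ℝ (Fin n)} {ue : EuclideanSpace ℝ (Fin l)}
    {ν : EuclideanSpace ℝ (Fin n)} {c : ℝ} {W : ℕ → Ω → EuclideanSpace ℝ (Fin m)}
    (h : p.Certificate (∫ ω, W 0 ω ∂μ) P S K xe ue ν c) (hQ₁ : p.Q₁.PosSemidef)
    (hQ₂ : p.Q₂.PosSemidef) (hR₁ : p.R₁.PosDef) (hR₂ : p.R₂.PosSemidef)
    (hWident : ∀ k, IdentDistrib (W k) (W 0) μ μ) (hW : ∀ k, MemLp (W k) 2 μ)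
    {ϱ : Measure (EuclideanSpace ℝ (Fin n))}
    {Xs : ℕ → Ω → EuclideanSpace ℝ (Fin n)} {Us : ℕ → Ω → EuclideanSpace ℝ (Fin l)}
    (hfs : p.IsFeedbackSolution μ W K xe ue ϱ Xs Us) (hlaw : ∀ k, HasLaw (Xs k) ϱ μ)
    (hXs : ∀ k, MemLp (Xs k) 2 μ) (hUs : ∀ k, MemLp (Us k) 2 μ)
    (hmX : ∀ k, ∫ ω, Xs k ω ∂μ = xe) (hmU : ∀ k, ∫ ω, Us k ω ∂μ = ue)
    (hiU : ∀ k, IndepFun (Us k) (W k) μ) :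
    p.IsStrictlyDissipativeWith μ W Xs Us fun r => c * r := by
  obtain ⟨s, hs, hS⟩ := exists_le_inner_toEuclideanLin h.posDef
  -- All `Xs k` share the law `ϱ`, so the bound of `neg_le_storage`, written as an integral over
  -- `ϱ`, is uniform in `k`.
  refine ⟨isKInfty_const_mul h.pos, fun k => storage μ P S ν xe (Xs k), fun k X Y hXY => ?_,
    ⟨-∫ x, (4 * s)⁻¹ * ‖ν - (2 : ℝ) • toEuclideanLin P (x - xe)‖ ^ 2 ∂ϱ, fun k X hX => ?_⟩,
    fun k X U hX hU iX iU => ?_⟩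
  · refine integral_congr_ae ?_
    filter_upwards [hXY] with ω hω
    rw [hω]
  · refine le_trans (le_of_eq ?_) (neg_le_storage hs hS hX (hXs k))
    have hc : Continuous fun x =>
        (4 * s)⁻¹ * ‖ν - (2 : ℝ) • toEuclideanLin P (x - xe)‖ ^ 2 := by
      have := LinearMap.continuous_of_finiteDimensional (toEuclideanLin P)
      fun_prop
    rw [← (hlaw k).integral_comp hc.aestronglyMeasurable]
    rfl
  · have hk : p.Certificate (∫ ω, W k ω ∂μ) P S K xe ue ν c := by
      rw [(hWident k).integral_eq]
      exact h
    exact hk.dissipation hQ₁ hQ₂ hR₁ hR₂ hX hU (hXs k) (hUs k) (hW k) iX iU (hfs.indep k) (hiU k)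
      (hmX k) (hmU k) (hfs.feedback k) (hfs.step k)

lemma isRiccatiSolution_iff {P : Matrix (Fin n) (Fin n) ℝ} : p.IsRiccatiSolution P ↔
    P.PosSemidef ∧ P = riccatiMap p.A p.B (p.Q₁ + p.Q₂) (p.R₁ + p.R₂) P := Iff.rfl

lemma gain_eq (P : Matrix (Fin n) (Fin n) ℝ) :
    p.gain P = riccatiGain p.A p.B (p.R₁ + p.R₂) P := rfl

/-- The polarised Riccati equation plus the first-order condition for the gain, which lets `v` be
arbitrary instead of the feedback value at `d`. -/
lemma IsRiccatiSolution.inner_eq {P : Matrix (Fin n) (Fin n) ℝ} (h : p.IsRiccatiSolution P)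
    (hR : (p.R₁ + p.R₂).PosDef) (d : EuclideanSpace ℝ (Fin n)) (v : EuclideanSpace ℝ (Fin l))
    (y : EuclideanSpace ℝ (Fin n)) :
    inner ℝ d (toEuclideanLin (p.Q₁ + p.Q₂) y) +
      inner ℝ v (toEuclideanLin (p.R₁ + p.R₂) (toEuclideanLin (p.gain P) y)) -
      inner ℝ d (toEuclideanLin P y) +
      inner ℝ (toEuclideanLin p.A d + toEuclideanLin p.B v)
        (toEuclideanLin P (toEuclideanLin p.A y +
          toEuclideanLin p.B (toEuclideanLin (p.gain P) y))) = 0 := by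
  obtain ⟨hP, hric⟩ := isRiccatiSolution_iff.1 h
  have h1 := inner_riccatiMap (A := p.A) (B := p.B) (Q := p.Q₁ + p.Q₂) (R := p.R₁ + p.R₂) (P := P)
    d y
  have h2 := riccatiGain_inner_stationary (A := p.A) (B := p.B) hR hP v y
  rw [← hric] at h1
  rw [← gain_eq] at h1 h2
  rw [inner_add_left (toEuclideanLin p.A d)]
  linarith

end LQProblem

end StochLQ

open StochLQ StochLQ.LQProblem in
theorem mainTheorem3 {n l m : ℕ} (p : StochLQ.LQProblem n l m)
    -- standing assumptions on the problem data
    (hstab : StochLQ.IsStabilizable p.A p.B)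
    (hQ₁ : p.Q₁.PosSemidef) (hQ₂ : p.Q₂.PosSemidef)
    (hR₁ : p.R₁.PosDef) (hR₂ : p.R₂.PosSemidef)
    -- the probability space and the i.i.d. square-integrable noise
    {Ω : Type*} [MeasurableSpace Ω] (μ : MeasureTheory.Measure Ω)
    [MeasureTheory.IsProbabilityMeasure μ]
    (W : ℕ → Ω → EuclideanSpace ℝ (Fin m))
    (hWmeas : ∀ k, Measurable (W k))
    (hWindep : ProbabilityTheory.iIndepFun W μ)
    (hWident : ∀ k, ProbabilityTheory.IdentDistrib (W k) (W 0) μ μ)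
    (hWL2 : ∀ k, MeasureTheory.MemLp (W k) 2 μ)
    -- existence of a deterministic steady state, and detectability
    (hsteady : ∃ xs us, p.IsSteadyState (∫ ω, W 0 ω ∂μ) xs us)
    (hdet : StochLQ.IsDetectable p.A (StochLQ.psdSqrt p.Q₁)) :
    ∃ (P : Matrix (Fin n) (Fin n) ℝ) (xe : EuclideanSpace ℝ (Fin n))
      (ue : EuclideanSpace ℝ (Fin l)) (ϱ : MeasureTheory.Measure (EuclideanSpace ℝ (Fin n)))
      (α : ℝ → ℝ),
      p.IsRiccatiSolution P ∧
      p.IsOptimalSteadyState (∫ ω, W 0 ω ∂μ) xe ue ∧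
      StochLQ.IsP2 ϱ ∧
      StochLQ.IsKInfty α ∧
      -- the stationary process exists if the probability space carries a uniform random variable
      -- that is independent of the noise
      ((∃ ξ : Ω → ℝ,
          ProbabilityTheory.HasLaw ξ (MeasureTheory.volume.restrict (Set.Icc 0 1)) μ ∧
          ProbabilityTheory.IndepFun ξ (fun ω k => W k ω) μ) →
        ∃ Xs Us, p.IsFeedbackSolution μ W (p.gain P) xe ue ϱ Xs Us) ∧
      -- every such process is stationary, the problem is strictly dissipative there, and it is a
      -- turnpike in probability
      ∀ Xs Us, p.IsFeedbackSolution μ W (p.gain P) xe ue ϱ Xs Us →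
        p.IsStationaryPair μ W Xs Us ∧
        p.IsStrictlyDissipativeWith μ W Xs Us α ∧
        ∀ X₀ : Ω → EuclideanSpace ℝ (Fin n), MeasureTheory.MemLp X₀ 2 μ →
          ∃ C : ℝ, ∀ (N : ℕ) (δ : ℝ), 0 < δ →
            ∀ U : ℕ → Ω → EuclideanSpace ℝ (Fin l), p.IsAdmissible μ W N X₀ U →
              p.cost μ W N X₀ U ≤
                δ + ∑ k ∈ Finset.range N, p.stageCost μ (Xs k) (Us k) →
              ∀ ε η : ℝ, 0 < ε → 0 < η →
                (N : ℝ) - (δ + C) / α (ε ^ 2 * η) ≤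
                  (StochLQ.turnpikeCount μ (p.traj W X₀ U) Xs N ε η : ℝ) := by
  have hR : (p.R₁ + p.R₂).PosDef := hR₁.add_posSemidef hR₂
  obtain ⟨P, hPric⟩ := hstab.exists_riccati (hQ₁.add hQ₂) hR
  have hP : p.IsRiccatiSolution P := isRiccatiSolution_iff.2 hPric
  obtain ⟨S, hS, c, hc, hdiss⟩ := hdet.exists_storage (B := p.B) hQ₁ hR₁
  obtain ⟨xe, ue, ν, hopt, hν⟩ := exists_optimalSteadyState hQ₁ hR₁ hc hdiss hsteady
  have hcert : p.Certificate (∫ ω, W 0 ω ∂μ) P S (p.gain P) xe ue ν c :=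
    ⟨hS, hc, hopt.1, hν, hP.inner_eq hR, hdiss⟩
  -- Since `Q₂` and `R₂` are nonnegative, the detectability inequality survives the passage to the
  -- larger weights of the Riccati equation.
  obtain ⟨b, r, hb, hr, hr1, hpow⟩ := exists_norm_pow_closedLoop_le hR hPric.1 hPric.2 hS hc
    fun x u => by
      have h1 := inner_toEuclideanLin_nonneg hQ₂ x
      have h2 := inner_toEuclideanLin_nonneg hR₂ u
      have h3 := hdiss x u
      rw [(toEuclideanLin (𝕜 := ℝ)).map_add p.Q₁, (toEuclideanLin (𝕜 := ℝ)).map_add p.R₁,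
        LinearMap.add_apply, LinearMap.add_apply, inner_add_right x, inner_add_right u]
      linarith
  rw [← gain_eq] at hpow
  -- `ρ` is the law of the deviation from `xe`; the stationary state law is its translate.
  obtain ⟨ρ, hρ, hρ2, hρ0, hρinv⟩ :=
    exists_stationary_law p.E hb hr hr1 hpow hWindep hWident hWL2
  have hadd : Measurable fun y : EuclideanSpace ℝ (Fin n) => y + xe := measurable_id.add_const xe
  have hϱlaw : HasLaw (fun y => y + xe) (ρ.map (· + xe)) ρ := ⟨hadd.aemeasurable, rfl⟩
  have hϱ2 : MemLp (fun y => y + xe) 2 ρ := hρ2.add (memLp_const xe)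
  have hϱP2 : IsP2 (ρ.map (· + xe)) := isP2_of_memLp hϱ2 hϱlaw
  have hϱ := hϱP2.1
  refine ⟨P, xe, ue, ρ.map (· + xe), fun r => c * r, hP, hopt, hϱP2, isKInfty_const_mul hc, ?_,
    fun Xs Us h => ?_⟩
  · rintro ⟨ξ, hξ, hξW⟩
    exact exists_isFeedbackSolution hWmeas hWindep _ hξ hξW
  have hlaw : ∀ k, HasLaw (Xs k) (ρ.map (· + xe)) μ := h.hasLaw hopt.1 hWident hρinv
  have hid2 : MemLp id 2 (ρ.map (· + xe)) :=
    (memLp_map_measure_iff aestronglyMeasurable_id hadd.aemeasurable).2 hϱ2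
  have hXs : ∀ k, MemLp (Xs k) 2 μ := fun k => by
    have := (hlaw k).map_eq ▸ hid2
    exact (memLp_map_measure_iff aestronglyMeasurable_id (hlaw k).aemeasurable).1 this
  have hfb : Measurable fun x => toEuclideanLin (p.gain P) (x - xe) + ue :=
    ((measurable_toEuclideanLin _).comp (measurable_id.sub_const xe)).add_const ue
  have hUs : ∀ k, MemLp (Us k) 2 μ := fun k =>
    ((memLp_toEuclideanLin (p.gain P) ((hXs k).sub (memLp_const xe))).add
      (memLp_const ue)).ae_eq (h.feedback k).symm
  -- The means of the stationary pair must be exactly `xe` and `ue`, so that the linearised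
  -- covariances are expressed in the deviations to which the Riccati identity applies.
  have hmY : ∀ k, ∫ ω, (Xs k ω - xe) ∂μ = 0 := fun k => by
    have := (hasLaw_sub_const_iff.1 (hlaw k)).integral_eq
    rw [this, hρ0]
  have hmX : ∀ k, ∫ ω, Xs k ω ∂μ = xe := fun k => by
    have := hmY k
    rw [integral_sub ((hXs k).integrable one_le_two) (integrable_const _)] at this
    simpa [sub_eq_zero] using this
  have hYint : ∀ k, Integrable (fun ω => Xs k ω - xe) μ := fun k =>
    ((hXs k).sub (memLp_const xe)).integrable one_le_two
  have hmU : ∀ k, ∫ ω, Us k ω ∂μ = ue := fun k => by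
    have hKY : Integrable (fun ω => toEuclideanLin (p.gain P) (Xs k ω - xe)) μ :=
      (memLp_toEuclideanLin _ ((hXs k).sub (memLp_const xe))).integrable one_le_two
    rw [integral_congr_ae (h.feedback k), integral_add hKY (integrable_const _),
      integral_toEuclideanLin (p.gain P) (hYint k), hmY, map_zero]
    simp
  have hiU : ∀ k, IndepFun (Us k) (W k) μ := fun k =>
    ((h.indep k).comp hfb measurable_id).congr (h.feedback k).symm Filter.EventuallyEq.rfl
  have hUlaw : ∀ k, HasLaw (Us k)
      ((ρ.map (· + xe)).map fun x => toEuclideanLin (p.gain P) (x - xe) + ue) μ := fun k =>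
    (HasLaw.fun_comp ⟨hfb.aemeasurable, rfl⟩ (hlaw k)).congr (h.feedback k)
  have hsd : p.IsStrictlyDissipativeWith μ W Xs Us fun r => c * r :=
    hcert.isStrictlyDissipativeWith hQ₁ hQ₂ hR₁ hR₂ hWident hWL2 h hlaw hXs hUs hmX hmU hiU
  exact ⟨⟨_, _, hϱP2, isP2_of_memLp (hUs 0) (hUlaw 0), fun k =>
      ⟨hlaw k, hUlaw k, h.indep k, hiU k, h.step k⟩⟩, hsd,
    fun X₀ hX₀ => hsd.exists_turnpike hc hWL2 hXs hX₀⟩
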